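/- A \emph{guarded multi-energy timed automaton} (guarded META) consists of finite sets of actions, locations, clocks and energy variables; an initial location; a non-empty set of private locations; a non-empty set of final locations, which are not private and have no outgoing edges; a labelling of the locations by finite sets of atomic propositions; for each location an invariant and an integer rate for each energy variable; and finitely many edges, each with a source and a target location, a guard, an action (possibly silent), a set of clocks to be reset to $0$, and an integer offset for each energy variable. Invariants and guards are finite conjunctions of inequalities $v \bowtie d$ with $v$ a clock or an energy variable, ${\bowtie} \in \{<,\leq,\geq,>\}$ and $d \in \mathbb{Z}$. A state is a location together with non-negative real values of all clocks and energy variables that satisfy the invariant of the location. Delaying by $d \geq 0$ in a location adds $d$ to every clock and $d$ times its rate to every energy variable, and is allowed if all the intermediate triples are states. Taking an edge between two states requires its guard, resets its clocks, and adds its offsets to the energy variables. A run is a finite sequence of steps (a delay followed by an edge) from the initial state, in which all clocks and energy variables are $0$ and which is assumed to satisfy the invariant of the initial location; its duration is the sum of its delays, and its final energies are the energy values in its last state. A run that ends in a final location is \emph{private} if it visits a private location, and \emph{public} otherwise. A guarded META is \emph{discrete} if all its rates are $0$, i.e. energies change along edges only. Let $\mathrm{Priv}$ and $\mathrm{Pub}$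 be the sets of observations of the private and of the public runs, where the observation of a run is its final energies for $\sigma = \mathrm{EN}$, and the pair of its duration and its final energies for $\sigma = \mathrm{ET\text{-}EN}$. The automaton is $\exists$-$\sigma$-opaque if $\mathrm{Priv} \cap \mathrm{Pub} \neq \emptyset$, weakly $\sigma$-opaque if $\mathrm{Priv} \subseteq \mathrm{Pub}$, and fully $\sigma$-opaque if $\mathrm{Priv} = \mathrm{Pub}$. \textbf{Proposition.} For each $\delta \in \{\exists, \text{weak}, \text{full}\}$ and each $\sigma \in \{\mathrm{EN}, \mathrm{ET\text{-}EN}\}$, the following problem is undecidable: given a discrete guarded META with exactly $2$ energy variables and $1$ clock, is it $\delta$-$\sigma$-opaque? -/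

import Mathlib

/-! ### Simple constraints -/

/-- The comparison operators `<`, `≤`, `≥`, `>`. -/
inductive Cmp where
  | lt | le | ge | gt
  deriving DecidableEq

/-- `c.Holds a b` means `a ⋈ b` for the operator `⋈` named by `c`. -/
def Cmp.Holds : Cmp → ℝ → ℝ → Prop
  | .lt, a, b => a < b
  | .le, a, b => a ≤ b
  | .ge, a, b => a ≥ b
  | .gt, a, b => a > b

/-- An inequality `v ⋈ d`, where `v` is a clock or an energy variable and `d` is an integer. -/
structure Atom (Clk En : Type) where
  var : Clk ⊕ En
  cmp : Cmp
  bound : ℤ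

/-- A simple constraint: a finite conjunction of inequalities `v ⋈ d`. -/
abbrev SimpleConstraint (Clk En : Type) := List (Atom Clk En)

/-- Satisfaction of a simple constraint by a clock valuation and an energy valuation. -/
def SimpleConstraint.Sat {Clk En : Type} (g : SimpleConstraint Clk En)
    (ν : Clk → ℝ) (v : En → ℝ) : Prop :=
  ∀ a ∈ g, a.cmp.Holds (Sum.elim ν v a.var) (a.bound : ℝ)

/-! ### Guarded multi-energy timed automata -/

/-- Edges `(ℓ, g, a, R, U, ℓ')`; the action `none` is the silent action `ε`. -/
structure METAEdge (Act Loc Clk En : Type) where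
  src : Loc
  guard : SimpleConstraint Clk En
  act : Option Act
  reset : Finset Clk
  upd : En → ℤ
  tgt : Loc

/-- Guarded multi-energy timed automata with actions `Act`, locations `Loc`, atomic propositions
`AP`, clocks `Clk` and energy variables `En`. The finite set of edges is given by a list of its
elements. -/
structure GuardedMETA (Act Loc AP Clk En : Type) where
  init : Loc
  priv : Finset Loc
  final : Finset Loc
  label : Loc → Finset AP
  inv : Loc → SimpleConstraint Clk En
  rate : Loc → En → ℤ
  edges : List (METAEdge Act Loc Clk En)
  priv_nonempty : priv.Nonempty
  final_nonempty : final.Nonempty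
  final_not_priv : ∀ l ∈ final, l ∉ priv
  final_no_outgoing : ∀ e ∈ edges, e.src ∉ final
  init_inv : (inv init).Sat (fun _ => 0) (fun _ => 0)

/-- Triples (location, clock valuation, energy valuation). -/
structure METAState (Loc Clk En : Type) where
  loc : Loc
  clk : Clk → ℝ
  en : En → ℝ

namespace GuardedMETA

variable {Act Loc AP Clk En : Type}

/-- The set `S` of concrete states: all clocks and energies are non-negative and the invariant of
the location holds. -/
def IsState (A : GuardedMETA Act Loc AP Clk En) (s : METAState Loc Clk En) : Prop :=
  (∀ x, 0 ≤ s.clk x) ∧ (∀ η, 0 ≤ s.en η) ∧ (A.inv s.loc).Sat s.clk s.en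

/-- The initial state: initial location, all clocks and energies `0`. -/
def initState (A : GuardedMETA Act Loc AP Clk En) : METAState Loc Clk En where
  loc := A.init
  clk := fun _ => 0
  en := fun _ => 0

/-- The triple obtained from `s` by letting `d` time units elapse. -/
def elapse (A : GuardedMETA Act Loc AP Clk En) (s : METAState Loc Clk En) (d : ℝ) :
    METAState Loc Clk En where
  loc := s.loc
  clk := fun x => s.clk x + d
  en := fun η => s.en η + (A.rate s.loc η : ℝ) * d

/-- Delay transitions. -/
def Delay (A : GuardedMETA Act Loc AP Clk En) (s : METAState Loc Clk En) (d : ℝ)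
    (t : METAState Loc Clk En) : Prop :=
  0 ≤ d ∧ t = A.elapse s d ∧ ∀ d', 0 ≤ d' → d' ≤ d → A.IsState (A.elapse s d')

/-- Discrete transitions. -/
def Fire (A : GuardedMETA Act Loc AP Clk En) (s : METAState Loc Clk En)
    (e : METAEdge Act Loc Clk En) (t : METAState Loc Clk En) : Prop :=
  A.IsState s ∧ A.IsState t ∧ e ∈ A.edges ∧ s.loc = e.src ∧ t.loc = e.tgt ∧
    (∀ x, (x ∈ e.reset → t.clk x = 0) ∧ (x ∉ e.reset → t.clk x = s.clk x)) ∧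
    (∀ η, t.en η = s.en η + (e.upd η : ℝ)) ∧
    e.guard.Sat s.clk s.en

/-- A delay followed by a discrete transition. -/
def Step (A : GuardedMETA Act Loc AP Clk En) (s : METAState Loc Clk En) (d : ℝ)
    (e : METAEdge Act Loc Clk En) (t : METAState Loc Clk En) : Prop :=
  ∃ s', A.Delay s d s' ∧ A.Fire s' e t

/-- Concrete runs; `Run A s` is the type of the runs of `A` from the initial state to `s`. -/
inductive Run (A : GuardedMETA Act Loc AP Clk En) : METAState Loc Clk En → Type
  | start : Run A A.initState
  | step {s t : METAState Loc Clk En} (r : Run A s) (d : ℝ) (e : METAEdge Act Loc Clk En)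
      (h : A.Step s d e t) : Run A t

/-- The duration of a run: the sum of its delays. -/
def Run.duration {A : GuardedMETA Act Loc AP Clk En} {s : METAState Loc Clk En} : A.Run s → ℝ
  | .start => 0
  | .step r d _ _ => r.duration + d

/-- `r.Visits L`: some state that belongs to the run has its location in `L`. -/
def Run.Visits {A : GuardedMETA Act Loc AP Clk En} {s : METAState Loc Clk En} (L : Finset Loc) :
    A.Run s → Prop
  | .start => A.init ∈ L
  | .step (t := t) r _ _ _ => r.Visits L ∨ t.loc ∈ L

/-- Private runs: they end in a final location and visit a private location. -/
def Run.IsPrivate {A : GuardedMETA Act Loc AP Clk En} {s : METAState Loc Clk En}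
    (r : A.Run s) : Prop :=
  s.loc ∈ A.final ∧ r.Visits A.priv

/-- Public runs: they end in a final location and visit no private location. -/
def Run.IsPublic {A : GuardedMETA Act Loc AP Clk En} {s : METAState Loc Clk En}
    (r : A.Run s) : Prop :=
  s.loc ∈ A.final ∧ ¬ r.Visits A.priv

/-- The final energies of the private runs. -/
def privEnergies (A : GuardedMETA Act Loc AP Clk En) : Set (En → ℝ) :=
  {v | ∃ (s : METAState Loc Clk En) (r : A.Run s), r.IsPrivate ∧ s.en = v}

/-- The final energies of the public runs. -/
def pubEnergies (A : GuardedMETA Act Loc AP Clk En) : Set (En → ℝ) :=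
  {v | ∃ (s : METAState Loc Clk En) (r : A.Run s), r.IsPublic ∧ s.en = v}

/-- The pairs (duration, final energies) of the private runs. -/
def privDurEnergies (A : GuardedMETA Act Loc AP Clk En) : Set (ℝ × (En → ℝ)) :=
  {p | ∃ (s : METAState Loc Clk En) (r : A.Run s),
    r.IsPrivate ∧ r.duration = p.1 ∧ s.en = p.2}

/-- The pairs (duration, final energies) of the public runs. -/
def pubDurEnergies (A : GuardedMETA Act Loc AP Clk En) : Set (ℝ × (En → ℝ)) :=
  {p | ∃ (s : METAState Loc Clk En) (r : A.Run s),
    r.IsPublic ∧ r.duration = p.1 ∧ s.en = p.2}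

/-- A guarded META is discrete if energies change along edges only, i.e. all rates are `0`. -/
def IsDiscrete (A : GuardedMETA Act Loc AP Clk En) : Prop :=
  ∀ l η, A.rate l η = 0

end GuardedMETA

/-! ### Opacity -/

/-- The three notions of opacity: `∃`, weak, full. -/
inductive OpacityKind where
  | exist | weak | full

/-- What is observed: the final energies (`EN`), or the duration of the run together with the
final energies (`ETEN`). -/
inductive Observation where
  | EN | ETEN

/-- The comparison of the private with the public observations. -/
def OpacityKind.Rel {α : Type} : OpacityKind → Set α → Set α → Prop
  | .exist, P, Q => (P ∩ Q).Nonempty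
  | .weak, P, Q => P ⊆ Q
  | .full, P, Q => P = Q

/-- `δ`-`σ`-opacity. -/
def GuardedMETA.Opaque {Act Loc AP Clk En : Type} (A : GuardedMETA Act Loc AP Clk En)
    (δ : OpacityKind) : Observation → Prop
  | .EN => δ.Rel A.privEnergies A.pubEnergies
  | .ETEN => δ.Rel A.privDurEnergies A.pubDurEnergies

/-! ### Guarded METAs as inputs of algorithms -/

/-- Guarded METAs with actions `0, …, k-1`, locations `0, …, n-1`, clocks `0, …, x-1`, energy
variables `0, …, m-1`, and natural numbers as names of atomic propositions. Up to renaming, these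
are all guarded METAs. -/
abbrev FinMETA (k n x m : ℕ) := GuardedMETA (Fin k) (Fin n) ℕ (Fin x) (Fin m)

/-- (clock or energy variable, operator, constant) -/
abbrev AtomCode := (ℕ ⊕ ℕ) × ℕ × ℤ

abbrev ConstraintCode := List AtomCode

/-- (source, guard, action, reset clocks, energy updates, target) -/
abbrev EdgeCode := ℕ × ConstraintCode × Option ℕ × List ℕ × List ℤ × ℕ

/-- (number of actions, of locations, of clocks, of energy variables, initial location,
private locations, final locations, labels, invariants, rates, edges), where a function on
locations or on energy variables is given by the list of its values. -/
abbrev METACode := ℕ × ℕ × ℕ × ℕ × ℕ × List ℕ × List ℕ × List (List ℕ) × List ConstraintCode ×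
  List (List ℤ) × List EdgeCode

def Cmp.code : Cmp → ℕ
  | .lt => 0
  | .le => 1
  | .ge => 2
  | .gt => 3

def Atom.code {x m : ℕ} (a : Atom (Fin x) (Fin m)) : AtomCode :=
  (a.var.map Fin.val Fin.val, a.cmp.code, a.bound)

def SimpleConstraint.code {x m : ℕ} (g : SimpleConstraint (Fin x) (Fin m)) : ConstraintCode :=
  g.map Atom.code

/-- The increasing list of the elements of a finite set. -/
def finsetCode {n : ℕ} (s : Finset (Fin n)) : List ℕ :=
  (s.sort (· ≤ ·)).map Fin.val

def METAEdge.code {k n x m : ℕ} (e : METAEdge (Fin k) (Fin n) (Fin x) (Fin m)) : EdgeCode :=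
  (e.src.val, e.guard.code, e.act.map Fin.val, finsetCode e.reset, List.ofFn e.upd, e.tgt.val)

/-- The finite word that describes a guarded META to an algorithm. -/
def GuardedMETA.code {k n x m : ℕ} (A : FinMETA k n x m) : METACode :=
  (k, n, x, m, A.init.val, finsetCode A.priv, finsetCode A.final,
    List.ofFn (fun l => (A.label l).sort (· ≤ ·)), List.ofFn (fun l => (A.inv l).code),
    List.ofFn (fun l => List.ofFn (A.rate l)), A.edges.map METAEdge.code)

/-- The property `P` is decidable on the class `C` of guarded METAs: some algorithm, given the
description of any member `A` of `C`, halts and answers whether `P A` holds. Nothing is required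
of the algorithm on other inputs. -/
def DecidableOnMETAs (C P : ∀ ⦃k n x m : ℕ⦄, FinMETA k n x m → Prop) : Prop :=
  ∃ f : METACode →. Bool, Partrec f ∧
    ∀ ⦃k n x m : ℕ⦄ (A : FinMETA k n x m), C A → ∃ b ∈ f A.code, (b = true ↔ P A)

/-! ### The description of a guarded META determines it -/

theorem Cmp.code_injective : Function.Injective Cmp.code := by
  intro a b h
  cases a <;> cases b <;> simp_all [Cmp.code]

theorem Atom.code_injective {x m : ℕ} :
    Function.Injective (Atom.code : Atom (Fin x) (Fin m) → AtomCode) := by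
  rintro ⟨v, c, d⟩ ⟨v', c', d'⟩ h
  simp only [Atom.code, Prod.mk.injEq] at h
  obtain ⟨h1, h2, h3⟩ := h
  have h1 := Function.Injective.sumMap Fin.val_injective Fin.val_injective h1
  have h2 := Cmp.code_injective h2
  subst h1 h2 h3
  rfl

theorem SimpleConstraint.code_injective {x m : ℕ} :
    Function.Injective (SimpleConstraint.code : SimpleConstraint (Fin x) (Fin m) → _) :=
  List.map_injective_iff.2 Atom.code_injective

theorem finsetCode_injective {n : ℕ} :
    Function.Injective (finsetCode : Finset (Fin n) → List ℕ) := by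
  intro s t h
  have h := List.map_injective_iff.2 Fin.val_injective h
  rw [← Finset.sort_toFinset s (· ≤ ·), h, Finset.sort_toFinset]

theorem METAEdge.code_injective {k n x m : ℕ} :
    Function.Injective (METAEdge.code : METAEdge (Fin k) (Fin n) (Fin x) (Fin m) → EdgeCode) := by
  rintro ⟨s, g, a, r, u, t⟩ ⟨s', g', a', r', u', t'⟩ h
  simp only [METAEdge.code, Prod.mk.injEq] at h
  obtain ⟨h1, h2, h3, h4, h5, h6⟩ := h
  have h1 := Fin.val_injective h1
  have h2 := SimpleConstraint.code_injective h2
  have h3 := Option.map_injective Fin.val_injective h3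
  have h4 := finsetCode_injective h4
  have h5 := List.ofFn_injective h5
  have h6 := Fin.val_injective h6
  subst h1 h2 h3 h4 h5 h6
  rfl

theorem GuardedMETA.code_injective {k n x m : ℕ} :
    Function.Injective (GuardedMETA.code : FinMETA k n x m → METACode) := by
  rintro ⟨i, p, f, l, v, r, e, _, _, _, _, _⟩ ⟨i', p', f', l', v', r', e', _, _, _, _, _⟩ h
  simp only [GuardedMETA.code, Prod.mk.injEq, true_and] at h
  obtain ⟨h1, h2, h3, h4, h5, h6, h7⟩ := h
  have h1 := Fin.val_injective h1
  have h2 := finsetCode_injective h2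
  have h3 := finsetCode_injective h3
  have h4 : l = l' := by
    funext q
    have := congrFun (List.ofFn_injective h4) q
    rw [← Finset.sort_toFinset (l q) (· ≤ ·), this, Finset.sort_toFinset]
  have h5 : v = v' := by
    funext q
    exact SimpleConstraint.code_injective (congrFun (List.ofFn_injective h5) q)
  have h6 : r = r' := by
    funext q
    exact List.ofFn_injective (congrFun (List.ofFn_injective h6) q)
  have h7 := List.map_injective_iff.2 METAEdge.code_injective h7
  subst h1 h2 h3 h4 h5 h6 h7
  rfl

/-- Two guarded METAs with the same description have the same numbers of actions, locations,
clocks and energy variables, and they are equal. -/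
theorem GuardedMETA.eq_of_code_eq {k n x m k' n' x' m' : ℕ} (A : FinMETA k n x m)
    (B : FinMETA k' n' x' m') (h : A.code = B.code) :
    k = k' ∧ n = n' ∧ x = x' ∧ m = m' ∧ HEq A B := by
  have h' := h
  simp only [GuardedMETA.code, Prod.mk.injEq] at h'
  obtain ⟨rfl, rfl, rfl, rfl, -⟩ := h'
  exact ⟨rfl, rfl, rfl, rfl, heq_of_eq (GuardedMETA.code_injective h)⟩

/-!
The proof reduces the halting problem to opacity. A partial recursive function is computed by a
register program, that is, by a relation on register contents that is built from increments,
decrements and zero tests by composition and iteration; every loop of the program is such an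
iteration, and it is left through a zero test. The registers `r₀, r₁, r₂, …` are stored in one
counter as the Gödel number `2 ^ r₀ * 3 ^ r₁ * 5 ^ r₂ * ⋯`: increments become multiplications,
decrements divisions, and zero tests tests for non-divisibility by a prime, all of which can be
performed with the help of a second counter. The two counters are the two energy variables.

The clock is kept at `0` by the invariants, so all runs have duration `0`. A private run goes
directly to the final location, with final energies `0`. The public runs simulate a computation on
a given input, and they set both counters to `0` if it halts. So there is exactly one private
observation, and the set of public observations is equal to the set of private ones or empty,
depending on whether the computation halts; hence all notions of opacity amount to halting.
-/

open Function Relation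

/-! ### Bisimulations and rational relations -/

section Bisimulation

variable {α β γ : Type*} {ρ : α → β → Prop} {R R' : α → α → Prop} {S S' : β → β → Prop}

/-- `ρ` is a bisimulation between the transition relations `R` and `S`: from related states, each
transition of one system is matched by a transition of the other into related states. -/
def Bisim (ρ : α → β → Prop) (R : α → α → Prop) (S : β → β → Prop) : Prop :=
  ∀ ⦃a b⦄, ρ a b →
    (∀ a', R a a' → ∃ b', S b b' ∧ ρ a' b') ∧ ∀ b', S b b' → ∃ a', R a a' ∧ ρ a' b'

namespace Bisim

theorem of_fun {F : α → α} {G : β → β} (h : ∀ a b, ρ a b → ρ (F a) (G b)) :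
    Bisim ρ (fun a a' => a' = F a) fun b b' => b' = G b := by
  rintro a b hab
  exact ⟨by rintro _ rfl; exact ⟨_, rfl, h a b hab⟩, by rintro _ rfl; exact ⟨_, rfl, h a b hab⟩⟩

theorem comp (h : Bisim ρ R S) (h' : Bisim ρ R' S') : Bisim ρ (Comp R R') (Comp S S') := by
  intro a b hab
  constructor
  · rintro a'' ⟨a', ha', ha''⟩
    obtain ⟨b', hb', hab'⟩ := (h hab).1 a' ha'
    obtain ⟨b'', hb'', hab''⟩ := (h' hab').1 a'' ha''
    exact ⟨b'', ⟨b', hb', hb''⟩, hab''⟩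
  · rintro b'' ⟨b', hb', hb''⟩
    obtain ⟨a', ha', hab'⟩ := (h hab).2 b' hb'
    obtain ⟨a'', ha'', hab''⟩ := (h' hab').2 b'' hb''
    exact ⟨a'', ⟨a', ha', ha''⟩, hab''⟩

theorem reflTransGen (h : Bisim ρ R S) : Bisim ρ (ReflTransGen R) (ReflTransGen S) := by
  intro a b hab
  constructor
  · intro a' ha
    induction ha with
    | refl => exact ⟨b, .refl, hab⟩
    | tail _ hstep ih =>
      obtain ⟨b', hb', hab'⟩ := ih
      obtain ⟨b'', hb'', hab''⟩ := (h hab').1 _ hstep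
      exact ⟨b'', hb'.tail hb'', hab''⟩
  · intro b' hb
    induction hb with
    | refl => exact ⟨a, .refl, hab⟩
    | tail _ hstep ih =>
      obtain ⟨a', ha', hab'⟩ := ih
      obtain ⟨a'', ha'', hab''⟩ := (h hab').2 _ hstep
      exact ⟨a'', ha'.tail ha'', hab''⟩

theorem trans {ρ' : β → γ → Prop} {T : γ → γ → Prop} (h : Bisim ρ R S) (h' : Bisim ρ' S T) :
    Bisim (Comp ρ ρ') R T := by
  rintro a c ⟨b, hab, hbc⟩
  constructor
  · intro a' ha
    obtain ⟨b', hb, hab'⟩ := (h hab).1 a' ha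
    obtain ⟨c', hc, hbc'⟩ := (h' hbc).1 b' hb
    exact ⟨c', hc, b', hab', hbc'⟩
  · intro c' hc
    obtain ⟨b', hb, hbc'⟩ := (h' hbc).2 c' hc
    obtain ⟨a', ha, hab'⟩ := (h hab).2 b' hb
    exact ⟨a', ha, b', hab', hbc'⟩

end Bisim

end Bisimulation

/-- The rational relations over the instructions `ι`, the instruction `i` being interpreted by
`sem i`: those obtained from the instructions by composition and iteration. A rational relation is
the input-output relation of a nondeterministic program; there is no union, because all programs
needed here branch only at loop exits. -/
inductive RationalRel {ι D : Type*} (sem : ι → D → D → Prop) : (D → D → Prop) → Prop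
  | instr (i : ι) : RationalRel sem (sem i)
  | comp {R S} : RationalRel sem R → RationalRel sem S → RationalRel sem (Comp R S)
  | star {R} : RationalRel sem R → RationalRel sem (ReflTransGen R)

/-- Some rational relation over `sem` is related by the bisimulation `ρ` to the relation `G`; that
is, some program behaves like `G` if its memory encodes the argument of `G` through `ρ`. -/
def Implements {ι D E : Type*} (sem : ι → D → D → Prop) (ρ : D → E → Prop)
    (G : E → E → Prop) : Prop :=
  ∃ R, RationalRel sem R ∧ Bisim ρ R G

namespace Implements

variable {ι κ D E E' : Type*} {sem : ι → D → D → Prop} {ρ : D → E → Prop} {G H : E → E → Prop}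

theorem of_instr (i : ι) (h : Bisim ρ (sem i) G) : Implements sem ρ G :=
  ⟨sem i, .instr i, h⟩

theorem congr (h : Implements sem ρ G) (hGH : ∀ s t, G s t ↔ H s t) : Implements sem ρ H := by
  obtain rfl : G = H := funext₂ fun s t => propext (hGH s t)
  exact h

theorem comp (hG : Implements sem ρ G) (hH : Implements sem ρ H) :
    Implements sem ρ (Comp G H) := by
  obtain ⟨R, hR, hRG⟩ := hG
  obtain ⟨S, hS, hSH⟩ := hH
  exact ⟨_, hR.comp hS, hRG.comp hSH⟩

theorem star (hG : Implements sem ρ G) : Implements sem ρ (ReflTransGen G) := by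
  obtain ⟨R, hR, hRG⟩ := hG
  exact ⟨_, hR.star, hRG.reflTransGen⟩

theorem trans_bisim {ρ' : E → E' → Prop} {G' : E' → E' → Prop} (hG : Implements sem ρ G)
    (h : Bisim ρ' G G') : Implements sem (Comp ρ ρ') G' := by
  obtain ⟨R, hR, hRG⟩ := hG
  exact ⟨R, hR, hRG.trans h⟩

theorem of_rationalRel {sem' : κ → E → E → Prop} (h : ∀ i, Implements sem ρ (sem' i))
    (hG : RationalRel sem' G) : Implements sem ρ G := by
  induction hG with
  | instr i => exact h i
  | comp _ _ ihG ihH => exact ihG.comp ihH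
  | star _ ih => exact ih.star

theorem trans {sem' : κ → E → E → Prop} {ρ' : E → E' → Prop} {G' : E' → E' → Prop}
    (h : ∀ i, Implements sem ρ (sem' i)) (h' : Implements sem' ρ' G') :
    Implements sem (Comp ρ ρ') G' := by
  obtain ⟨R, hR, hRG⟩ := h'
  exact (of_rationalRel h hR).trans_bisim hRG

theorem fun_comp {F F' : E → E} (hF : Implements sem ρ fun s t => t = F s)
    (hF' : Implements sem ρ fun s t => t = F' s) : Implements sem ρ fun s t => t = F' (F s) :=
  (hF.comp hF').congr fun s t => by simp only [Comp, exists_eq_left]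

end Implements

/-! ### Register machines -/

/-- The instructions of a register machine. -/
inductive RegInstr where
  | inc (i : ℕ) | dec (i : ℕ) | isZero (i : ℕ)

/-- The effect of an instruction on the register contents; `dec` is blocked on an empty register,
and `isZero` on a non-empty one. -/
def RegInstr.sem : RegInstr → (ℕ → ℕ) → (ℕ → ℕ) → Prop
  | .inc i, s, t => t = update s i (s i + 1)
  | .dec i, s, t => s i ≠ 0 ∧ t = update s i (s i - 1)
  | .isZero i, s, t => s i = 0 ∧ t = s

/-- Two register contents agree on the registers `0, …, m - 1`. -/
def AgreeBelow (m : ℕ) (s t : ℕ → ℕ) : Prop := ∀ j < m, s j = t j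

/-- Some register program behaves like the relation `G` on the registers `0, …, m - 1`. It may use
the other registers for intermediate results; nothing is assumed about their initial contents. -/
abbrev Performs (m : ℕ) (G : (ℕ → ℕ) → (ℕ → ℕ) → Prop) : Prop :=
  Implements RegInstr.sem (AgreeBelow m) G

theorem AgreeBelow.update {m : ℕ} {s t : ℕ → ℕ} (h : AgreeBelow m s t) (i x : ℕ) :
    AgreeBelow m (update s i x) (update t i x) := fun j hj => by
  simp only [update_apply, h j hj]

theorem AgreeBelow.comp_eq {m m' : ℕ} (hm : m ≤ m') :
    Comp (AgreeBelow m') (AgreeBelow m) = AgreeBelow m := by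
  funext s t
  refine propext ⟨?_, fun h => ⟨s, fun _ _ => rfl, h⟩⟩
  rintro ⟨u, hsu, hut⟩ j hj
  exact (hsu j (hj.trans_le hm)).trans (hut j hj)

theorem reflTransGen_guarded_iff {α : Type*} {p : α → Prop} {f : α → α} {s t : α} :
    ReflTransGen (fun s t => p s ∧ t = f s) s t ↔ ∃ k, (∀ i < k, p (f^[i] s)) ∧ t = f^[k] s := by
  constructor
  · intro h
    induction h with
    | refl => exact ⟨0, by simp, rfl⟩
    | tail _ hstep ih =>
      obtain ⟨k, hk, rfl⟩ := ih
      refine ⟨k + 1, fun i hi => ?_, by rw [hstep.2, iterate_succ_apply']⟩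
      rcases Nat.lt_succ_iff_lt_or_eq.1 hi with hi | rfl
      exacts [hk i hi, hstep.1]
  · rintro ⟨k, hk, rfl⟩
    induction k with
    | zero => exact .refl
    | succ k ih =>
      exact (ih fun i hi => hk i (hi.trans k.lt_succ_self)).tail
        ⟨hk k k.lt_succ_self, iterate_succ_apply' f k s⟩

namespace Performs

variable {m m' a b c i : ℕ} {G G' : (ℕ → ℕ) → (ℕ → ℕ) → Prop} {F F' : (ℕ → ℕ) → ℕ → ℕ}

theorem inc (hi : i < m) : Performs m fun s t => t = update s i (s i + 1) :=
  .of_instr (.inc i) <| .of_fun fun s t h => by rw [h i hi]; exact h.update i _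

theorem dec (hi : i < m) : Performs m fun s t => s i ≠ 0 ∧ t = update s i (s i - 1) := by
  refine .of_instr (.dec i) fun s t h => ?_
  simp only [RegInstr.sem, h i hi]
  exact ⟨fun _ ⟨h0, ht⟩ => ⟨_, ⟨h0, rfl⟩, ht ▸ h.update i _⟩,
    fun _ ⟨h0, ht⟩ => ⟨_, ⟨h0, rfl⟩, ht ▸ h.update i _⟩⟩

theorem isZero (hi : i < m) : Performs m fun s t => s i = 0 ∧ t = s := by
  refine .of_instr (.isZero i) fun s t h => ?_
  simp only [RegInstr.sem, h i hi]
  exact ⟨fun _ ⟨h0, ht⟩ => ⟨_, ⟨h0, rfl⟩, ht ▸ h⟩, fun _ ⟨h0, ht⟩ => ⟨_, ⟨h0, rfl⟩, ht ▸ h⟩⟩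

theorem mono (hm : m ≤ m') (h : Performs m' G) (hG : Bisim (AgreeBelow m) G G') :
    Performs m G' := by
  have := h.trans_bisim hG
  rwa [AgreeBelow.comp_eq hm] at this

theorem mono_fun (hm : m ≤ m') (h : Performs m' fun s t => t = F s)
    (hF : ∀ s t, AgreeBelow m s t → AgreeBelow m (F s) (F' t)) :
    Performs m fun s t => t = F' s :=
  h.mono hm (.of_fun hF)

theorem dec_comp (hi : i < m) (hF : Performs m fun s t => t = F s) :
    Performs m fun s t => s i ≠ 0 ∧ t = F (update s i (s i - 1)) :=
  ((dec hi).comp hF).congr fun s t => by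
    simp only [Comp, and_assoc, exists_and_left, exists_eq_left]

theorem while_ne_zero (hc : c < m) (h : Performs m fun s t => s c ≠ 0 ∧ t = F s) :
    Performs m fun s t => ∃ k, (∀ i < k, F^[i] s c ≠ 0) ∧ F^[k] s c = 0 ∧ t = F^[k] s :=
  (h.star.comp (isZero hc)).congr fun s t => by
    simp only [Comp, reflTransGen_guarded_iff (p := fun s : ℕ → ℕ => s c ≠ 0)]
    constructor
    · rintro ⟨_, ⟨k, hk, rfl⟩, h0, rfl⟩
      exact ⟨k, hk, h0, rfl⟩
    · rintro ⟨k, hk, h0, rfl⟩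
      exact ⟨_, ⟨k, hk, rfl⟩, h0, rfl⟩

theorem iterate_countdown (hF : ∀ s, F s c = s c - 1) (k : ℕ) (s : ℕ → ℕ) :
    F^[k] s c = s c - k := by
  induction k with
  | zero => rfl
  | succ k ih => rw [iterate_succ_apply', hF, ih, Nat.sub_sub]

theorem loop (hc : c < m) (h : Performs m fun s t => s c ≠ 0 ∧ t = F s)
    (hF : ∀ s, F s c = s c - 1) : Performs m fun s t => t = F^[s c] s :=
  (while_ne_zero hc h).congr fun s t => by
    simp only [iterate_countdown hF]
    constructor
    · rintro ⟨k, hk, h0, rfl⟩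
      obtain rfl : k = s c := by
        refine le_antisymm (not_lt.1 fun h => hk _ h (Nat.sub_self _)) (Nat.sub_eq_zero_iff_le.1 h0)
      rfl
    · exact fun ht => ⟨s c, fun i hi => Nat.sub_ne_zero_of_lt hi, Nat.sub_self _, ht⟩

theorem setZero (hc : c < m) : Performs m fun s t => t = update s c 0 := by
  refine (loop hc (dec hc) fun s => by simp only [update_self]).congr fun s t => Eq.congr_right ?_
  have iterate_dec (n : ℕ) :
      (fun s : ℕ → ℕ => update s c (s c - 1))^[n] s = update s c (s c - n) := by
    induction n with
    | zero => simp only [iterate_zero_apply, Nat.sub_zero, update_eq_self]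
    | succ n ih => rw [iterate_succ_apply', ih, update_self, update_idem, Nat.sub_sub]
  rw [iterate_dec, Nat.sub_self]

/-- Emptying register `a` into two registers at once is what makes copying possible: one of the
two then serves to restore `a`. -/
theorem addTo₂ (ha : a < m) (hb : b < m) (hc : c < m) (hab : a ≠ b) (hac : a ≠ c) (hbc : b ≠ c) :
    Performs m fun s t =>
      t = update (update (update s b (s b + s a)) c (s c + s a)) a 0 := by
  refine (loop ha (dec_comp ha ((inc hb).fun_comp (inc hc)))
    fun s => by simp only [update_self, update_of_ne, ne_eq, hab, hac, not_false_eq_true]).congr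
    fun s t => Eq.congr_right ?_
  have iterate_body (n : ℕ) : (fun s : ℕ → ℕ =>
      (fun s : ℕ → ℕ => update s c (s c + 1)) ((fun s : ℕ → ℕ => update s b (s b + 1))
        (update s a (s a - 1))))^[n] s =
      update (update (update s b (s b + n)) c (s c + n)) a (s a - n) := by
    induction n with
    | zero => simp
    | succ n ih =>
      rw [iterate_succ_apply', ih]
      funext j
      grind [update_apply]
  rw [← Nat.sub_self (s a)]
  exact iterate_body (s a)

theorem copy (ha : a < m) (hb : b < m) : Performs m fun s t => t = update s b (s a) := by
  by_cases hab : a = b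
  · subst hab
    exact ((inc ha).comp (dec ha)).congr fun s t => by simp [Comp]
  have h0 : m < m + 2 := by omega
  have h1 : m + 1 < m + 2 := by omega
  have ha' : a < m + 2 := by omega
  have hb' : b < m + 2 := by omega
  refine mono_fun (m' := m + 2) (by omega) (((setZero hb').fun_comp (setZero h0)).fun_comp
    (addTo₂ ha' hb' h0 hab ha.ne hb.ne) |>.fun_comp
    (addTo₂ h0 ha' h1 ha.ne' (by omega) (by omega))) fun s t hst j hj => ?_
  have := hst j hj
  have := hst a ha
  grind [update_apply]

end Performs

/-- The partial function `f` is computed by register programs, for every choice of input registers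
`a i` and of an output register `b`. -/
def RegComputes {n : ℕ} (f : List.Vector ℕ n →. ℕ) : Prop :=
  ∀ (a : Fin n → ℕ) (b m : ℕ), (∀ i, a i < m) → b < m →
    Performs m fun s t => ∃ y ∈ f (List.Vector.ofFn fun i => s (a i)), t = update s b y

theorem regComputes_coe_iff {n : ℕ} {f : List.Vector ℕ n → ℕ} :
    RegComputes (f : List.Vector ℕ n →. ℕ) ↔
      ∀ (a : Fin n → ℕ) (b m : ℕ), (∀ i, a i < m) → b < m →
        Performs m fun s t => t = update s b (f (List.Vector.ofFn fun i => s (a i))) := by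
  simp only [RegComputes, PFun.coe_val, Part.mem_some_iff, exists_eq_left]

theorem AgreeBelow.ofFn_eq {m n : ℕ} {s t : ℕ → ℕ} (h : AgreeBelow m s t) {a : Fin n → ℕ}
    (ha : ∀ i, a i < m) :
    (List.Vector.ofFn fun i => s (a i)) = List.Vector.ofFn fun i => t (a i) :=
  congrArg List.Vector.ofFn (funext fun i => h _ (ha i))

theorem vector_ofFn_cons {n : ℕ} (s : ℕ → ℕ) (j : ℕ) (a : Fin n → ℕ) :
    (List.Vector.ofFn fun i => s ((Fin.cons j a : Fin (n + 1) → ℕ) i)) =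
      s j ::ᵥ List.Vector.ofFn fun i => s (a i) := rfl

theorem mem_mOfFn {n : ℕ} {g : Fin n → Part ℕ} {v : List.Vector ℕ n} :
    v ∈ List.Vector.mOfFn g ↔ ∀ i, v.get i ∈ g i := by
  induction n with
  | zero => simp [List.Vector.mOfFn, eq_iff_true_of_subsingleton]
  | succ n ih =>
    simp only [List.Vector.mOfFn, Part.bind_eq_bind, Part.mem_bind_iff, ih, Part.pure_eq_some,
      Part.mem_some_iff, Fin.forall_fin_succ]
    constructor
    · rintro ⟨x, hx, w, hw, rfl⟩
      exact ⟨by simpa using hx, by simpa using hw⟩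
    · rintro ⟨h0, h1⟩
      exact ⟨_, h0, v.tail, fun i => by rw [List.Vector.get_tail_succ]; exact h1 i,
        by rw [List.Vector.get_zero, List.Vector.cons_head_tail]⟩

/-- The contents of the registers after `k` rounds of a loop started on `s`: register `m` counts the
rounds, register `m + 1` holds the intermediate result `x`, and the registers below are intact. -/
def LoopState (m : ℕ) (s : ℕ → ℕ) (k x : ℕ) (u : ℕ → ℕ) : Prop :=
  AgreeBelow m u s ∧ u m = k ∧ u (m + 1) = x

namespace LoopState

variable {m k x : ℕ} {s u : ℕ → ℕ} {F : (ℕ → ℕ) → ℕ → ℕ} {r : ℕ → ℕ}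

theorem iterate (h0 : LoopState m s 0 (r 0) u)
    (hF : ∀ k u, LoopState m s k (r k) u → LoopState m s (k + 1) (r (k + 1)) (F u)) (k : ℕ) :
    LoopState m s k (r k) (F^[k] u) := by
  induction k with
  | zero => exact h0
  | succ k ih => rw [iterate_succ_apply']; exact hF k _ ih

theorem update_of_lt (h : LoopState m s k x u) {i : ℕ} (hi : m + 1 < i) (y : ℕ) :
    LoopState m s k x (update u i y) := by
  obtain ⟨hs, hk, hx⟩ := h
  refine ⟨fun j hj => ?_, ?_, ?_⟩ <;> rw [update_of_ne (by omega)]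
  exacts [hs j hj, hk, hx]

theorem update_index (h : LoopState m s k x u) (y : ℕ) : LoopState m s y x (update u m y) := by
  obtain ⟨hs, -, hx⟩ := h
  refine ⟨fun j hj => ?_, update_self .., ?_⟩ <;> rw [update_of_ne (by omega)]
  exacts [hs j hj, hx]

theorem update_result (h : LoopState m s k x u) (y : ℕ) :
    LoopState m s k y (update u (m + 1) y) := by
  obtain ⟨hs, hk, -⟩ := h
  refine ⟨fun j hj => ?_, ?_, update_self ..⟩ <;> rw [update_of_ne (by omega)]
  exacts [hs j hj, hk]

theorem congr_ofFn (h : LoopState m s k x u) {n : ℕ} {a : Fin n → ℕ} (ha : ∀ i, a i < m) :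
    (List.Vector.ofFn fun i => u (a i)) = List.Vector.ofFn fun i => s (a i) :=
  h.1.ofFn_eq ha

end LoopState

namespace Performs

variable {m b : ℕ} {F₀ F : (ℕ → ℕ) → ℕ → ℕ} {r : (ℕ → ℕ) → ℕ → ℕ}

theorem for_loop {N : (ℕ → ℕ) → ℕ} (hb : b < m) (hinit : Performs (m + 3) fun s t => t = F₀ s)
    (hbody : Performs (m + 3) fun s t => t = F s)
    (h0 : ∀ s u, AgreeBelow m u s → LoopState m s 0 (r s 0) (F₀ u) ∧ F₀ u (m + 2) = N s)
    (hF : ∀ s k u, LoopState m s k (r s k) u → LoopState m s (k + 1) (r s (k + 1)) (F u))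
    (hF' : ∀ u, F u (m + 2) = u (m + 2)) :
    Performs m fun s t => t = update s b (r s (N s)) := by
  refine mono_fun (m' := m + 3) (by omega) ((hinit.fun_comp
    (loop (c := m + 2) (by omega) (dec_comp (by omega) hbody) fun s => by
      rw [hF', update_self])).fun_comp
    (copy (a := m + 1) (b := b) (by omega) (by omega))) fun u s hu => ?_
  obtain ⟨hstart, hN⟩ := h0 s u hu
  obtain ⟨hs, -, hr⟩ := hstart.iterate (r := r s)
    (fun k u h => hF s k _ (h.update_of_lt (i := m + 2) (by omega) (u (m + 2) - 1))) (N s)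
  rw [hN, hr]
  exact hs.update b _

theorem search_loop (hb : b < m) (hinit : Performs (m + 2) fun s t => t = F₀ s)
    (hbody : Performs (m + 2) fun s t => t = F s)
    (h0 : ∀ s u, AgreeBelow m u s → LoopState m s 0 (r s 0) (F₀ u))
    (hF : ∀ s k x u, LoopState m s k x u → LoopState m s (k + 1) (r s (k + 1)) (F u)) :
    Performs m fun s t => ∃ k, (∀ i < k, r s i ≠ 0) ∧ r s k = 0 ∧ t = update s b k := by
  refine mono (m' := m + 2) (by omega) ((hinit.comp
    (while_ne_zero (c := m + 1) (by omega) (dec_comp (by omega) hbody))).comp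
    (copy (a := m) (b := b) (by omega) (by omega))) fun u s hu => ?_
  have hloop := (h0 s u hu).iterate (r := r s)
    fun k u h => hF s k _ _ (h.update_result (u (m + 1) - 1))
  simp only [Comp, exists_eq_left, (hloop _).2.2]
  constructor
  · rintro _ ⟨_, ⟨k, hk, hk0, rfl⟩, rfl⟩
    exact ⟨_, ⟨k, hk, hk0, rfl⟩, (hloop k).2.1.symm ▸ (hloop k).1.update b k⟩
  · rintro _ ⟨k, hk, hk0, rfl⟩
    exact ⟨_, ⟨_, ⟨k, hk, hk0, rfl⟩, rfl⟩, (hloop k).2.1.symm ▸ (hloop k).1.update b k⟩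

end Performs

namespace RegComputes

theorem zero : RegComputes (n := 0) (fun _ => 0 : List.Vector ℕ 0 → ℕ) :=
  regComputes_coe_iff.2 fun _ _ _ _ hb => .setZero hb

theorem get {n : ℕ} (i : Fin n) :
    RegComputes (n := n) (fun v => v.get i : List.Vector ℕ n → ℕ) := by
  refine regComputes_coe_iff.2 fun a b m ha hb => ?_
  simp only [List.Vector.get_ofFn]
  exact .copy (ha i) hb

theorem succ : RegComputes (n := 1) (fun v => v.head.succ : List.Vector ℕ 1 → ℕ) := by
  refine regComputes_coe_iff.2 fun a b m ha hb => ?_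
  refine ((Performs.copy (ha 0) hb).fun_comp (Performs.inc hb)).congr fun s t => ?_
  rw [update_self, update_idem]
  rfl

theorem gather {n l m k : ℕ} {g : Fin n → List.Vector ℕ l →. ℕ} (hg : ∀ i, RegComputes (g i))
    {a : Fin l → ℕ} (ha : ∀ i, a i < m) (hk : k ≤ n) :
    Performs (m + (n + 1)) fun s t =>
      (∀ i : Fin n, i < k → t (m + i) ∈ g i (List.Vector.ofFn fun i => s (a i))) ∧
      ∀ j, j < m ∨ m + k ≤ j → t j = s j := by
  induction k with
  | zero =>
    refine (Performs.copy (a := m) (b := m) (by omega) (by omega)).congr fun s t => ?_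
    rw [update_eq_self]
    exact ⟨fun h => ⟨fun i hi => absurd hi (Nat.not_lt_zero i), fun j _ => congrFun h j⟩,
      fun h => funext fun j => h.2 j (by omega)⟩
  | succ k ih =>
    refine ((ih (by omega)).comp (hg ⟨k, hk⟩ a (m + k) (m + (n + 1))
      (fun i => (ha i).trans_le (by omega)) (by omega))).congr fun s t => ?_
    constructor
    · rintro ⟨u, ⟨hu, hus⟩, y, hy, rfl⟩
      have hargs : AgreeBelow m u s := fun j hj => hus j (.inl hj)
      refine ⟨fun i hi => ?_, fun j hj => ?_⟩
      · rcases Nat.lt_succ_iff_lt_or_eq.1 hi with hi | hi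
        · rw [update_of_ne (by omega)]
          exact hu i hi
        · obtain rfl : i = ⟨k, hk⟩ := Fin.ext hi
          rwa [update_self, ← hargs.ofFn_eq ha]
      · rw [update_of_ne (by omega)]
        exact hus j (by omega)
    · rintro ⟨ht, hts⟩
      have hargs : AgreeBelow m (update t (m + k) (s (m + k))) s := fun j hj => by
        rw [update_of_ne (by omega), hts j (.inl hj)]
      refine ⟨update t (m + k) (s (m + k)), ⟨fun i hi => ?_, fun j hj => ?_⟩, t (m + k), ?_, ?_⟩
      · rw [update_of_ne (by omega)]
        exact ht i (by omega)
      · rcases eq_or_ne j (m + k) with rfl | hjk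
        · rw [update_self]
        · rw [update_of_ne hjk, hts j (by omega)]
      · rw [hargs.ofFn_eq ha]
        exact ht ⟨k, hk⟩ k.lt_succ_self
      · rw [update_idem, update_eq_self]

theorem comp {l n : ℕ} {f : List.Vector ℕ n →. ℕ} {g : Fin n → List.Vector ℕ l →. ℕ}
    (hf : RegComputes f) (hg : ∀ i, RegComputes (g i)) :
    RegComputes fun v => List.Vector.mOfFn (fun i => g i v) >>= f := by
  intro a b m ha hb
  refine Performs.mono (by omega) ((gather hg ha le_rfl).comp
    (hf (fun i => m + i) b (m + (n + 1)) (fun i => by omega) (by omega))) fun s s' hs => ?_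
  have hmem (z : ℕ) : z ∈ (List.Vector.mOfFn fun i => g i (List.Vector.ofFn fun i => s' (a i)))
      >>= f ↔ ∃ w : List.Vector ℕ n,
        (∀ i, w.get i ∈ g i (List.Vector.ofFn fun i => s (a i))) ∧ z ∈ f w := by
    simp only [hs.ofFn_eq ha, ← mem_mOfFn (g := fun i => g i _)]
    exact Part.mem_bind_iff
  simp only [hmem]
  constructor
  · rintro _ ⟨u, ⟨hu, hus⟩, z, hz, rfl⟩
    refine ⟨_, ⟨z, ⟨_, fun i => ?_, hz⟩, rfl⟩, AgreeBelow.update (fun j hj => ?_) b z⟩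
    · rw [List.Vector.get_ofFn]
      exact hu i i.2
    · rw [hus j (.inl hj), hs j hj]
  · rintro _ ⟨z, ⟨w, hw, hz⟩, rfl⟩
    let u : ℕ → ℕ := fun j => if h : m ≤ j ∧ j - m < n then w.get ⟨j - m, h.2⟩ else s j
    have hu (i : Fin n) : u (m + i) = w.get i := by simp [u]
    have hus (j : ℕ) (hj : j < m ∨ m + n ≤ j) : u j = s j := dif_neg (by omega)
    refine ⟨_, ⟨u, ⟨fun i _ => (hu i).symm ▸ hw i, hus⟩, z, ?_, rfl⟩,
      AgreeBelow.update (fun j hj => ?_) b z⟩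
    · simpa only [hu, List.Vector.ofFn_get] using hz
    · rw [hus j (.inl hj), hs j hj]

theorem comp_coe {l n : ℕ} {f : List.Vector ℕ n → ℕ} {g : Fin n → List.Vector ℕ l → ℕ}
    (hf : RegComputes (f : List.Vector ℕ n →. ℕ))
    (hg : ∀ i, RegComputes (g i : List.Vector ℕ l →. ℕ)) :
    RegComputes (n := l) (fun v => f (List.Vector.ofFn fun i => g i v) : List.Vector ℕ l → ℕ) := by
  have bind_eq : (fun v => (List.Vector.mOfFn fun i => (g i : List.Vector ℕ l →. ℕ) v) >>=
      (f : List.Vector ℕ n →. ℕ)) =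
      ((fun v => f (List.Vector.ofFn fun i => g i v) : List.Vector ℕ l → ℕ) :
        List.Vector ℕ l →. ℕ) :=
    funext fun v => (congrArg (Part.bind · (f : List.Vector ℕ n →. ℕ))
      (Vector.mOfFn_part_some fun i => g i v)).trans (Part.bind_some _ _)
  exact bind_eq ▸ hf.comp hg

theorem prec {n : ℕ} {f : List.Vector ℕ n → ℕ} {g : List.Vector ℕ (n + 2) → ℕ}
    (hf : RegComputes (f : List.Vector ℕ n →. ℕ))
    (hg : RegComputes (g : List.Vector ℕ (n + 2) →. ℕ)) :
    RegComputes (n := n + 1) (fun v => v.head.rec (f v.tail) fun y IH => g (y ::ᵥ IH ::ᵥ v.tail) :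
      List.Vector ℕ (n + 1) → ℕ) := by
  refine regComputes_coe_iff.2 fun a b m ha hb => ?_
  rw [regComputes_coe_iff] at hf hg
  have ha' (i : Fin (n + 1)) : a i < m + 3 := (ha i).trans_le (by omega)
  let args : Fin (n + 2) → ℕ := Fin.cons m (Fin.cons (m + 1) fun i => a i.succ)
  have hargs : ∀ i, args i < m + 3 :=
    Fin.cases (by simp [args]) (Fin.cases (by simp [args]) fun i => ha' i.succ)
  refine (Performs.for_loop (m := m) (N := fun s => s (a 0)) (r := fun s k => k.rec
      (f (List.Vector.ofFn fun i => s (a i.succ)))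
      fun y IH => g (y ::ᵥ IH ::ᵥ List.Vector.ofFn fun i => s (a i.succ))) hb
    (((Performs.setZero (c := m) (by omega)).fun_comp
      (hf (fun i => a i.succ) (m + 1) (m + 3) (fun i => ha' i.succ) (by omega))).fun_comp
      (Performs.copy (a := a 0) (b := m + 2) (ha' 0) (by omega)))
    ((hg args (m + 1) (m + 3) hargs (by omega)).fun_comp (Performs.inc (i := m) (by omega)))
    (fun s u hu => ?_) (fun s k u hu => ?_) fun u => ?_)
  · have hstart : LoopState m s 0 _ (update u m 0) :=
      LoopState.update_index (k := u m) ⟨hu, rfl, rfl⟩ 0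
    rw [hstart.congr_ofFn fun i => ha i.succ]
    have hresult := hstart.update_result (f (List.Vector.ofFn fun i => s (a i.succ)))
    exact ⟨hresult.update_of_lt (by omega) _, by rw [update_self, hresult.1 _ (ha 0)]⟩
  · rw [vector_ofFn_cons, vector_ofFn_cons, hu.congr_ofFn fun i => ha i.succ, hu.2.1, hu.2.2]
    rw [(hu.update_result _).2.1]
    exact (hu.update_result _).update_index _
  · rw [update_of_ne (by omega), update_of_ne (by omega)]

theorem rfind {n : ℕ} {f : List.Vector ℕ (n + 1) → ℕ}
    (hf : RegComputes (f : List.Vector ℕ (n + 1) →. ℕ)) :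
    RegComputes fun v => Nat.rfind fun k => Part.some (f (k ::ᵥ v) = 0) := by
  intro a b m ha hb
  rw [regComputes_coe_iff] at hf
  let args : Fin (n + 1) → ℕ := Fin.cons m a
  have eval := hf args (m + 1) (m + 2)
    (Fin.cases (by simp [args]) fun i => (ha i).trans_le (by omega)) (by omega)
  refine (Performs.search_loop (m := m)
    (r := fun s k => f (k ::ᵥ List.Vector.ofFn fun i => s (a i)))
    hb ((Performs.setZero (c := m) (by omega)).fun_comp eval)
    ((Performs.inc (i := m) (by omega)).fun_comp eval)
    (fun s u hu => ?_) fun s k x u hu => ?_).congr fun s t => ?_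
  · have hstart : LoopState m s 0 _ (update u m 0) :=
      LoopState.update_index (k := u m) ⟨hu, rfl, rfl⟩ 0
    rw [vector_ofFn_cons, hstart.congr_ofFn ha, hstart.2.1]
    exact hstart.update_result _
  · have hnext := hu.update_index (k + 1)
    rw [hu.2.1, vector_ofFn_cons, hnext.congr_ofFn ha, hnext.2.1]
    exact hnext.update_result _
  · have mem_rfind (v : List.Vector ℕ n) (k : ℕ) :
        k ∈ (Nat.rfind fun k => Part.some (f (k ::ᵥ v) = 0)) ↔
          (∀ i < k, f (i ::ᵥ v) ≠ 0) ∧ f (k ::ᵥ v) = 0 :=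
      Nat.mem_rfind.trans (by simp [and_comm])
    simp only [mem_rfind, and_assoc]

theorem of_primrec' {n : ℕ} {f : List.Vector ℕ n → ℕ} (hf : Nat.Primrec' f) :
    RegComputes (f : List.Vector ℕ n →. ℕ) := by
  induction hf with
  | zero => exact zero
  | succ => exact succ
  | get i => exact get i
  | comp g _ _ hf hg => exact hf.comp_coe hg
  | prec _ _ hf hg => exact hf.prec hg

theorem of_partrec' {n : ℕ} {f : List.Vector ℕ n →. ℕ} (hf : Nat.Partrec' f) :
    RegComputes f := by
  induction hf with
  | prim hf => exact of_primrec' hf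
  | comp g _ _ hf hg => exact hf.comp hg
  | rfind _ hf => exact hf.rfind

end RegComputes

/-! ### Two-counter machines -/

/-- The instructions of a machine with two counters: these are the guards and the offsets of the
edges of a discrete guarded META with two energy variables and one clock, which plays no role. -/
structure CounterInstr where
  guard : SimpleConstraint (Fin 1) (Fin 2)
  upd : Fin 2 → ℤ

/-- The effect of an instruction on the two counters. -/
def CounterInstr.sem (a : CounterInstr) (d e : Fin 2 → ℕ) : Prop :=
  a.guard.Sat (fun _ => 0) (fun i => (d i : ℝ)) ∧ ∀ i, (e i : ℤ) = d i + a.upd i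

/-- Two counters of which the first one contains `N` and the second one is empty. -/
def HoldsFirst (d : Fin 2 → ℕ) (N : ℕ) : Prop := d = ![N, 0]

namespace CounterInstr

theorem implements_eq (a : CounterInstr) : Implements sem Eq a.sem :=
  .of_instr a <| by rintro d _ rfl; exact ⟨fun e he => ⟨e, he, rfl⟩, fun e he => ⟨e, he, rfl⟩⟩

theorem sem_interval {d e : Fin 2 → ℕ} {i : Fin 2} {b c : ℕ} :
    sem ⟨[⟨.inr i, .ge, b⟩, ⟨.inr i, .le, c⟩], 0⟩ d e ↔ (b ≤ d i ∧ d i ≤ c) ∧ e = d := by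
  simp [sem, SimpleConstraint.Sat, Cmp.Holds, funext_iff]

/-- The intermediate values are non-negative because they lie between the first and the last. -/
theorem reflTransGen_sem_add_iff {u : Fin 2 → ℤ} {d e : Fin 2 → ℕ} :
    ReflTransGen (sem ⟨[], u⟩) d e ↔ ∃ k : ℕ, ∀ i, (e i : ℤ) = d i + k * u i := by
  have sem_add (d e : Fin 2 → ℕ) : sem ⟨[], u⟩ d e ↔ ∀ i, (e i : ℤ) = d i + u i := by
    simp [sem, SimpleConstraint.Sat]
  constructor
  · intro h
    induction h with
    | refl => exact ⟨0, by simp⟩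
    | tail _ hstep ih =>
      obtain ⟨k, hk⟩ := ih
      refine ⟨k + 1, fun i => ?_⟩
      rw [(sem_add _ _).1 hstep i, hk i]
      push_cast
      ring
  · rintro ⟨k, hk⟩
    induction k generalizing e with
    | zero =>
      obtain rfl : e = d := funext fun i => by simpa using hk i
      exact .refl
    | succ k ih =>
      push_cast at hk
      have hnonneg (i : Fin 2) : 0 ≤ (d i : ℤ) + k * u i := by
        rcases le_total 0 (u i) with h | h
        · positivity
        · have := hk i
          linarith
      have hmid (i : Fin 2) : (((d i + k * u i : ℤ).toNat : ℕ) : ℤ) = d i + k * u i :=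
        Int.toNat_of_nonneg (hnonneg i)
      refine (ih hmid).tail ((sem_add _ _).2 fun i => ?_)
      rw [hk i, hmid i]
      ring

theorem implements_restore : Implements sem Eq fun d e => e = ![d 0 + d 1, 0] :=
  ((implements_eq ⟨[], ![1, -1]⟩).star.comp
    (implements_eq ⟨[⟨.inr 1, .ge, (0 : ℕ)⟩, ⟨.inr 1, .le, (0 : ℕ)⟩], 0⟩)).congr fun d e => by
    simp only [Comp, reflTransGen_sem_add_iff, sem_interval, Fin.forall_fin_two, funext_iff,
      Matrix.cons_val_zero, Matrix.cons_val_one]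
    constructor
    · rintro ⟨u, ⟨k, h0, h1⟩, h, he0, he1⟩
      omega
    · rintro ⟨h0, h1⟩
      exact ⟨e, ⟨d 1, by omega, by omega⟩, by omega, rfl, rfl⟩

/-- Take `a` from the first counter and add `b` to the second one as often as desired, check that
the remainder lies in `[l, u]`, and move the contents of the second counter back. -/
theorem implements_convert (a b l u : ℕ) : Implements sem HoldsFirst fun N M =>
    ∃ k r, N = k * a + r ∧ l ≤ r ∧ r ≤ u ∧ M = r + k * b := by
  have h := (((implements_eq ⟨[], ![-(a : ℤ), b]⟩).star.comp
    (implements_eq ⟨[⟨.inr 0, .ge, l⟩, ⟨.inr 0, .le, u⟩], 0⟩)).comp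
    implements_restore).trans_bisim (ρ' := HoldsFirst)
    (G' := fun N M => ∃ k r, N = k * a + r ∧ l ≤ r ∧ r ≤ u ∧ M = r + k * b) ?_
  · rwa [eq_comp] at h
  rintro d N rfl
  simp only [Comp, reflTransGen_sem_add_iff, sem_interval, Fin.forall_fin_two,
    Matrix.cons_val_zero, Matrix.cons_val_one, HoldsFirst]
  constructor
  · rintro _ ⟨c, ⟨_, ⟨k, h0, h1⟩, ⟨hl, hu⟩, rfl⟩, rfl⟩
    obtain rfl : N = k * a + c 0 := by zify; linarith
    have hc : c 1 = k * b := by zify; simpa using h1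
    exact ⟨_, ⟨k, c 0, rfl, hl, hu, rfl⟩, by rw [hc]⟩
  · rintro _ ⟨k, r, rfl, hl, hu, rfl⟩
    exact ⟨_, ⟨_, ⟨![r, k * b], ⟨k, by simp, by simp⟩, ⟨hl, hu⟩, rfl⟩, rfl⟩, rfl⟩

theorem implements_mul (p : ℕ) : Implements sem HoldsFirst fun N M => M = N * p :=
  (implements_convert 1 p 0 0).congr fun N M => by
    constructor
    · rintro ⟨k, r, rfl, -, hr, rfl⟩
      obtain rfl : r = 0 := by omega
      simp
    · rintro rfl
      exact ⟨N, 0, by simp⟩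

theorem implements_div {p : ℕ} (hp : 0 < p) :
    Implements sem HoldsFirst fun N M => p ∣ N ∧ M = N / p :=
  (implements_convert p 1 0 0).congr fun N M => by
    constructor
    · rintro ⟨k, r, rfl, -, hr, rfl⟩
      obtain rfl : r = 0 := by omega
      simp [hp]
    · rintro ⟨⟨k, rfl⟩, rfl⟩
      exact ⟨k, 0, by simp [hp, mul_comm]⟩

theorem implements_not_dvd {p : ℕ} (hp : 0 < p) :
    Implements sem HoldsFirst fun N M => ¬ p ∣ N ∧ M = N :=
  (implements_convert p p 1 (p - 1)).congr fun N M => by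
    constructor
    · rintro ⟨k, r, rfl, hr, hrp, rfl⟩
      refine ⟨fun h => ?_, by ring⟩
      have := Nat.le_of_dvd hr ((Nat.dvd_add_right (dvd_mul_left p k)).1 h)
      omega
    · rintro ⟨h, rfl⟩
      have hpos : 1 ≤ M % p := Nat.one_le_iff_ne_zero.2 (h ∘ Nat.dvd_of_mod_eq_zero)
      have hlt := Nat.mod_lt M hp
      have hdiv := Nat.div_add_mod' M p
      exact ⟨M / p, M % p, by omega, hpos, by omega, by omega⟩

end CounterInstr

/-- The Gödel number `N` represents the register contents `s`: the exponents of its prime factors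
are the contents of the registers. In particular only finitely many registers are non-empty. -/
def Represents (N : ℕ) (s : ℕ → ℕ) : Prop :=
  N ≠ 0 ∧ ∀ i, N.factorization (Nat.nth Nat.Prime i) = s i

theorem factorization_nth_prime (i j : ℕ) :
    (Nat.nth Nat.Prime i).factorization (Nat.nth Nat.Prime j) = if j = i then 1 else 0 := by
  rw [(Nat.prime_nth_prime i).factorization, Finsupp.single_apply]
  have := (Nat.nth_injective Nat.infinite_setOfPred_prime).eq_iff (a := i) (b := j)
  simp only [this, eq_comm]

namespace Represents

variable {N : ℕ} {s : ℕ → ℕ}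

theorem two_pow (n : ℕ) : Represents (2 ^ n) (update 0 0 n) := by
  refine ⟨by positivity, fun i => ?_⟩
  have two_eq : 2 = Nat.nth Nat.Prime 0 := Nat.nth_prime_zero_eq_two.symm
  rw [Nat.factorization_pow, two_eq, Finsupp.smul_apply, factorization_nth_prime, update_apply]
  split_ifs <;> simp

theorem dvd_iff (h : Represents N s) (i : ℕ) : Nat.nth Nat.Prime i ∣ N ↔ s i ≠ 0 := by
  rw [← h.2 i, (Nat.prime_nth_prime i).dvd_iff_one_le_factorization h.1, Nat.one_le_iff_ne_zero]

theorem mul (h : Represents N s) (i : ℕ) :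
    Represents (N * Nat.nth Nat.Prime i) (update s i (s i + 1)) := by
  have hp := (Nat.prime_nth_prime i).ne_zero
  refine ⟨mul_ne_zero h.1 hp, fun j => ?_⟩
  rw [Nat.factorization_mul h.1 hp, Finsupp.add_apply, h.2, factorization_nth_prime, update_apply]
  split_ifs with hj <;> simp [hj]

theorem div (h : Represents N s) {i : ℕ} (hi : s i ≠ 0) :
    Represents (N / Nat.nth Nat.Prime i) (update s i (s i - 1)) := by
  have hd := (h.dvd_iff i).2 hi
  refine ⟨(Nat.div_pos (Nat.le_of_dvd (Nat.pos_of_ne_zero h.1) hd)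
    (Nat.prime_nth_prime i).pos).ne', fun j => ?_⟩
  rw [Nat.factorization_div hd, Finsupp.tsub_apply, h.2, factorization_nth_prime, update_apply]
  split_ifs with hj <;> simp [hj]

end Represents

theorem RegInstr.implements_sem (a : RegInstr) :
    Implements CounterInstr.sem (Comp HoldsFirst Represents) a.sem := by
  cases a with
  | inc i => exact (CounterInstr.implements_mul _).trans_bisim (.of_fun fun _ _ h => h.mul i)
  | dec i =>
    refine (CounterInstr.implements_div (Nat.prime_nth_prime i).pos).trans_bisim fun N s h => ?_
    simp only [sem, h.dvd_iff]
    exact ⟨by rintro _ ⟨hi, rfl⟩; exact ⟨_, ⟨hi, rfl⟩, h.div hi⟩,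
      by rintro _ ⟨hi, rfl⟩; exact ⟨_, ⟨hi, rfl⟩, h.div hi⟩⟩
  | isZero i =>
    refine (CounterInstr.implements_not_dvd (Nat.prime_nth_prime i).pos).trans_bisim
      fun N s h => ?_
    simp only [sem, h.dvd_iff, not_not]
    exact ⟨by rintro _ ⟨hi, rfl⟩; exact ⟨_, ⟨hi, rfl⟩, h⟩,
      by rintro _ ⟨hi, rfl⟩; exact ⟨_, ⟨hi, rfl⟩, h⟩⟩

theorem exists_rationalRel_iff_dom {f : ℕ →. ℕ} (hf : Nat.Partrec f) :
    ∃ T, RationalRel CounterInstr.sem T ∧ ∀ n e, T ![2 ^ n, 0] e ↔ (f n).Dom ∧ e = 0 := by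
  have hf' : Nat.Partrec' fun v : List.Vector ℕ 1 => f v.head :=
    Nat.Partrec'.of_part (Partrec.comp (Partrec.nat_iff.2 hf) Computable.vector_head)
  obtain ⟨R, hR, hRf⟩ := Implements.trans RegInstr.implements_sem
    (RegComputes.of_partrec' hf' (fun _ => 0) 0 1 (fun _ => one_pos) one_pos)
  obtain ⟨Z, hZ, hZ0⟩ := CounterInstr.implements_mul 0
  refine ⟨_, hR.comp hZ, fun n e => ?_⟩
  have hinput : Comp (Comp HoldsFirst Represents) (AgreeBelow 1) ![2 ^ n, 0] (update 0 0 n) :=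
    ⟨_, ⟨_, rfl, .two_pow n⟩, fun _ _ => rfl⟩
  constructor
  · rintro ⟨d, hd, he⟩
    obtain ⟨t, ⟨y, hy, -⟩, _, ⟨N, hdN, -⟩, -⟩ := (hRf hinput).1 d hd
    obtain ⟨M, rfl, rfl⟩ := (hZ0 hdN).1 e he
    exact ⟨Part.dom_iff_mem.2 ⟨y, by simpa [← List.Vector.get_zero] using hy⟩, by simp⟩
  · rintro ⟨h, rfl⟩
    obtain ⟨y, hy⟩ := Part.dom_iff_mem.1 h
    obtain ⟨d, hd, _, ⟨N, hdN, -⟩, -⟩ :=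
      (hRf hinput).2 _ ⟨y, by simpa [← List.Vector.get_zero] using hy, rfl⟩
    obtain ⟨e, he, hez⟩ := (hZ0 hdN).2 _ rfl
    obtain rfl : e = 0 := hez.trans (by simp)
    exact ⟨d, hd, he⟩

/-! ### Program graphs -/

/-- The edges of a program graph with locations `Q` and instructions `ι`. -/
structure ProgramEdge (ι Q : Type*) where
  src : Q
  instr : ι
  tgt : Q

/-- The image of an edge under a map of locations. -/
def ProgramEdge.map {ι Q Q' : Type*} (f : Q → Q') (e : ProgramEdge ι Q) : ProgramEdge ι Q' :=
  ⟨f e.src, e.instr, f e.tgt⟩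

/-- The transitions of the program graph with edges `E` between pairs of a location and a memory
content. -/
inductive ProgramStep {ι D Q : Type*} (sem : ι → D → D → Prop) (E : List (ProgramEdge ι Q)) :
    Q × D → Q × D → Prop
  | mk {e d d'} (he : e ∈ E) (h : sem e.instr d d') : ProgramStep sem E (e.src, d) (e.tgt, d')

/-- The program graph with edges `E`, entry `a` and exit `b` has the input-output relation `T`. -/
def ProgramComputes {ι D Q : Type*} (sem : ι → D → D → Prop) (E : List (ProgramEdge ι Q)) (a b : Q)
    (T : D → D → Prop) : Prop :=
  ∀ d e, ReflTransGen (ProgramStep sem E) (a, d) (b, e) ↔ T d e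

section ProgramGraph

variable {ι D Q Q' : Type*} {sem : ι → D → D → Prop} {E : List (ProgramEdge ι Q)}
  {E' : List (ProgramEdge ι Q')} {a b : Q} {a' b' : Q'} {R S : D → D → Prop} {ε : ι}

theorem ProgramStep.reflTransGen_map (f : Q → Q') (hE : ∀ e ∈ E, e.map f ∈ E') {p q : Q × D}
    (h : ReflTransGen (ProgramStep sem E) p q) :
    ReflTransGen (ProgramStep sem E') (p.map f id) (q.map f id) := by
  refine h.lift (Prod.map f id) ?_
  rintro _ _ ⟨he, hstep⟩
  exact .mk (hE _ he) hstep

theorem ProgramStep.silent (hε : ∀ d e, sem ε d e ↔ e = d) (h : ⟨a, ε, b⟩ ∈ E) (d : D) :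
    ProgramStep sem E (a, d) (b, d) :=
  .mk h ((hε d d).2 rfl)

namespace ProgramComputes

theorem instr (i : ι) : ProgramComputes sem [⟨false, i, true⟩] false true (sem i) := by
  refine fun d e => ⟨fun h => ?_, fun h => .single (.mk (List.mem_singleton_self _) h)⟩
  let Inv : Bool × D → Prop
    | (false, e) => e = d
    | (true, e) => sem i d e
  suffices ∀ p, ReflTransGen (ProgramStep sem [⟨false, i, true⟩]) (false, d) p → Inv p from this _ h
  intro p hp
  induction hp with
  | refl => exact rfl
  | tail _ hstep ih =>
    obtain ⟨he, hi⟩ := hstep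
    obtain rfl := List.mem_singleton.1 he
    obtain rfl : _ = d := ih
    exact hi

/-- The graph of a composition: a silent edge leads from the exit of the first graph to the entry
of the second one. -/
def compEdges (ε : ι) (E : List (ProgramEdge ι Q)) (b : Q) (E' : List (ProgramEdge ι Q'))
    (a' : Q') : List (ProgramEdge ι (Q ⊕ Q')) :=
  ⟨.inl b, ε, .inr a'⟩ :: (E.map (.map .inl) ++ E'.map (.map .inr))

theorem comp (hε : ∀ d e, sem ε d e ↔ e = d) (h : ProgramComputes sem E a b R)
    (h' : ProgramComputes sem E' a' b' S) :
    ProgramComputes sem (compEdges ε E b E' a') (.inl a) (.inr b') (Comp R S) := by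
  intro d e
  constructor
  · let Inv : (Q ⊕ Q') × D → Prop
      | (.inl q, e) => ReflTransGen (ProgramStep sem E) (a, d) (q, e)
      | (.inr q, e) => ∃ z, R d z ∧ ReflTransGen (ProgramStep sem E') (a', z) (q, e)
    suffices ∀ p, ReflTransGen (ProgramStep sem (compEdges ε E b E' a')) (.inl a, d) p → Inv p by
      intro hde
      obtain ⟨z, hz, hze⟩ := this _ hde
      exact ⟨z, hz, (h' _ _).1 hze⟩
    intro p hp
    induction hp with
    | refl => exact ReflTransGen.refl
    | tail _ hstep ih =>
      obtain ⟨hc, hi⟩ := hstep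
      rw [compEdges, List.mem_cons, List.mem_append, List.mem_map, List.mem_map] at hc
      rcases hc with rfl | ⟨c, hc, rfl⟩ | ⟨c, hc, rfl⟩
      · rw [(hε _ _).1 hi]
        exact ⟨_, (h _ _).1 ih, .refl⟩
      · exact ReflTransGen.tail ih (.mk hc hi)
      · obtain ⟨z, hz, hzc⟩ := ih
        exact ⟨z, hz, hzc.tail (.mk hc hi)⟩
  · rintro ⟨z, hz, hze⟩
    have hleft := ProgramStep.reflTransGen_map (E' := compEdges ε E b E' a') .inl
      (fun c hc => by simp [compEdges, List.mem_map_of_mem hc]) ((h d z).2 hz)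
    have hright := ProgramStep.reflTransGen_map (E' := compEdges ε E b E' a') .inr
      (fun c hc => by simp [compEdges, List.mem_map_of_mem hc]) ((h' z e).2 hze)
    exact (hleft.tail (.silent hε (by simp [compEdges]) z)).trans hright

/-- The graph of an iteration: the additional location `none` is entry and exit, and silent edges
lead from it to the entry of the given graph and back from the exit of that graph. -/
def starEdges (ε : ι) (E : List (ProgramEdge ι Q)) (a b : Q) : List (ProgramEdge ι (Option Q)) :=
  ⟨none, ε, some a⟩ :: ⟨some b, ε, none⟩ :: E.map (.map some)

theorem star (hε : ∀ d e, sem ε d e ↔ e = d) (h : ProgramComputes sem E a b R) :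
    ProgramComputes sem (starEdges ε E a b) none none (ReflTransGen R) := by
  intro d e
  constructor
  · let Inv : Option Q × D → Prop
      | (none, e) => ReflTransGen R d e
      | (some q, e) => ∃ z, ReflTransGen R d z ∧ ReflTransGen (ProgramStep sem E) (a, z) (q, e)
    suffices ∀ p, ReflTransGen (ProgramStep sem (starEdges ε E a b)) (none, d) p → Inv p from this _
    intro p hp
    induction hp with
    | refl => exact ReflTransGen.refl
    | tail _ hstep ih =>
      obtain ⟨hc, hi⟩ := hstep
      rw [starEdges, List.mem_cons, List.mem_cons, List.mem_map] at hc
      rcases hc with rfl | rfl | ⟨c, hc, rfl⟩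
      · rw [(hε _ _).1 hi]
        exact ⟨_, ih, .refl⟩
      · rw [(hε _ _).1 hi]
        obtain ⟨z, hz, hzb⟩ := ih
        exact hz.tail ((h _ _).1 hzb)
      · obtain ⟨z, hz, hzc⟩ := ih
        exact ⟨z, hz, hzc.tail (.mk hc hi)⟩
  · intro hde
    induction hde with
    | refl => exact .refl
    | @tail y z _ hyz ih =>
      have hbody := ProgramStep.reflTransGen_map (E' := starEdges ε E a b) some
        (fun c hc => by simp [starEdges, List.mem_map_of_mem hc]) ((h y z).2 hyz)
      exact ((ih.tail (.silent hε (by simp [starEdges]) y)).trans hbody).tail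
        (.silent hε (by simp [starEdges]) z)

end ProgramComputes

theorem exists_programComputes {T : D → D → Prop} (hε : ∀ d e, sem ε d e ↔ e = d)
    (hT : RationalRel sem T) :
    ∃ (Q : Type) (_ : Finite Q) (E : List (ProgramEdge ι Q)) (a b : Q),
      ProgramComputes sem E a b T := by
  induction hT with
  | instr i => exact ⟨Bool, inferInstance, _, _, _, .instr i⟩
  | comp _ _ ih ih' =>
    obtain ⟨Q, _, E, a, b, h⟩ := ih
    obtain ⟨Q', _, E', a', b', h'⟩ := ih'
    exact ⟨Q ⊕ Q', inferInstance, _, _, _, h.comp hε h'⟩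
  | star _ ih =>
    obtain ⟨Q, _, E, a, b, h⟩ := ih
    exact ⟨Option Q, inferInstance, _, _, _, h.star hε⟩

end ProgramGraph

/-! ### Runs and opacity of guarded METAs -/

namespace GuardedMETA

variable {Act Loc AP Clk En : Type} {A : GuardedMETA Act Loc AP Clk En}

theorem Run.visits_of_loc_mem {s : METAState Loc Clk En} (r : A.Run s) {S : Finset Loc}
    (h : s.loc ∈ S) : r.Visits S := by
  cases r with
  | start => exact h
  | step r d e hs => exact .inr h

theorem privEnergies_eq_image : A.privEnergies = Prod.snd '' A.privDurEnergies := by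
  ext v
  constructor
  · rintro ⟨s, r, hr, rfl⟩
    exact ⟨(r.duration, s.en), ⟨s, r, hr, rfl, rfl⟩, rfl⟩
  · rintro ⟨_, ⟨s, r, hr, -, hen⟩, rfl⟩
    exact ⟨s, r, hr, hen⟩

theorem pubEnergies_eq_image : A.pubEnergies = Prod.snd '' A.pubDurEnergies := by
  ext v
  constructor
  · rintro ⟨s, r, hr, rfl⟩
    exact ⟨(r.duration, s.en), ⟨s, r, hr, rfl, rfl⟩, rfl⟩
  · rintro ⟨_, ⟨s, r, hr, -, hen⟩, rfl⟩
    exact ⟨s, r, hr, hen⟩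

end GuardedMETA

theorem OpacityKind.rel_singleton_iff {α : Type} (δ : OpacityKind) (x : α) (D : Prop) :
    δ.Rel {x} {y | D ∧ y = x} ↔ D := by
  cases δ <;> simp [OpacityKind.Rel, Set.Nonempty, Set.ext_iff]

theorem GuardedMETA.opaque_iff_of_privDurEnergies_eq_singleton {Act Loc AP Clk En : Type}
    {A : GuardedMETA Act Loc AP Clk En} {x : ℝ × (En → ℝ)} {D : Prop}
    (hpriv : A.privDurEnergies = {x}) (hpub : A.pubDurEnergies = {y | D ∧ y = x})
    (δ : OpacityKind) (σ : Observation) : A.Opaque δ σ ↔ D := by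
  have hsnd : Prod.snd '' {y | D ∧ y = x} = {v | D ∧ v = x.2} := by ext v; aesop
  cases σ with
  | EN =>
    rw [Opaque, privEnergies_eq_image, pubEnergies_eq_image, hpriv, hpub, Set.image_singleton, hsnd,
      OpacityKind.rel_singleton_iff]
  | ETEN => rw [Opaque, hpriv, hpub, OpacityKind.rel_singleton_iff]

/-! ### Program graphs with two counters as guarded METAs -/

/-- The instruction without effect. -/
def CounterInstr.silent : CounterInstr := ⟨[], 0⟩

theorem CounterInstr.sem_silent {d e : Fin 2 → ℕ} : silent.sem d e ↔ e = d := by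
  simp [silent, sem, SimpleConstraint.Sat, funext_iff]

/-- A program graph with two counters together with the locations that matter for opacity; there is
just one private and one final location. -/
structure CounterProgram (G : Type) where
  edges : List (ProgramEdge CounterInstr G)
  init : G
  priv : G
  final : G
  final_ne_priv : final ≠ priv
  src_ne_final : ∀ e ∈ edges, e.src ≠ final

namespace CounterProgram

variable {G L : Type} (P : CounterProgram G)

/-- The transitions of a program between pairs of a location and the contents of the counters. -/
abbrev Step : G × (Fin 2 → ℕ) → G × (Fin 2 → ℕ) → Prop := ProgramStep CounterInstr.sem P.edges

/-- Some path of the program from `x` to `y` visits the private location. -/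
def PrivatePath (x y : G × (Fin 2 → ℕ)) : Prop :=
  ∃ e, ReflTransGen P.Step x (P.priv, e) ∧ ReflTransGen P.Step (P.priv, e) y

/-- Some path of the program from `x` to `y` does not visit the private location. -/
def PublicPath (x y : G × (Fin 2 → ℕ)) : Prop :=
  x.1 ≠ P.priv ∧ ReflTransGen (fun y z => P.Step y z ∧ z.1 ≠ P.priv) x y

/-- The discrete guarded META whose energies are the counters of the program `P`. Its locations are
numbered by `loc`. All invariants are `x ≤ 0`, so that time cannot elapse. -/
def toMETA (loc : G ↪ L) : GuardedMETA (Fin 0) L ℕ (Fin 1) (Fin 2) where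
  init := loc P.init
  priv := {loc P.priv}
  final := {loc P.final}
  label _ := ∅
  inv _ := [⟨.inl 0, .le, 0⟩]
  rate _ _ := 0
  edges := P.edges.map fun e => ⟨loc e.src, e.instr.guard, none, ∅, e.instr.upd, loc e.tgt⟩
  priv_nonempty := Finset.singleton_nonempty _
  final_nonempty := Finset.singleton_nonempty _
  final_not_priv := by simpa using P.final_ne_priv
  final_no_outgoing := by simpa using P.src_ne_final
  init_inv := by simp [SimpleConstraint.Sat, Cmp.Holds]

/-- The state in which the clock shows `0` and the energies are given by the counters. -/
def state (l : L) (d : Fin 2 → ℕ) : METAState L (Fin 1) (Fin 2) :=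
  ⟨l, fun _ => 0, fun η => d η⟩

variable {P} {loc : G ↪ L}

theorem isState_iff {s : METAState L (Fin 1) (Fin 2)} :
    (P.toMETA loc).IsState s ↔ s.clk = 0 ∧ ∀ η, 0 ≤ s.en η := by
  simp only [GuardedMETA.IsState, toMETA, SimpleConstraint.Sat, Cmp.Holds, funext_iff,
    Fin.forall_fin_one, List.mem_singleton, forall_eq, Sum.elim_inl, Int.cast_zero, Pi.zero_apply]
  exact ⟨fun h => ⟨le_antisymm h.2.2 h.1, h.2.1⟩, fun h => ⟨h.1.ge, h.2, h.1.le⟩⟩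

theorem isState_state (l : L) (d : Fin 2 → ℕ) : (P.toMETA loc).IsState (state l d) :=
  isState_iff.2 ⟨rfl, fun _ => Nat.cast_nonneg _⟩

theorem initState_toMETA : (P.toMETA loc).initState = state (loc P.init) 0 := by
  simp [GuardedMETA.initState, state, toMETA]

theorem elapse_state_zero (l : L) (d : Fin 2 → ℕ) :
    (P.toMETA loc).elapse (state l d) 0 = state l d := by
  simp [GuardedMETA.elapse, state]

theorem delay_state_iff {l : L} {d : Fin 2 → ℕ} {δ : ℝ} {t : METAState L (Fin 1) (Fin 2)} :
    (P.toMETA loc).Delay (state l d) δ t ↔ δ = 0 ∧ t = state l d := by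
  constructor
  · rintro ⟨hδ, rfl, h⟩
    obtain rfl : δ = 0 := by
      simpa [GuardedMETA.elapse, state] using congrFun (isState_iff.1 (h δ hδ le_rfl)).1 0
    exact ⟨rfl, elapse_state_zero l d⟩
  · rintro ⟨rfl, rfl⟩
    refine ⟨le_rfl, (elapse_state_zero l d).symm, fun δ h h' => ?_⟩
    rw [le_antisymm h' h, elapse_state_zero]
    exact isState_state l d

theorem exists_fire_state_iff {g : G} {d : Fin 2 → ℕ} {t : METAState L (Fin 1) (Fin 2)} :
    (∃ e, (P.toMETA loc).Fire (state (loc g) d) e t) ↔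
      ∃ g' d', t = state (loc g') d' ∧ P.Step (g, d) (g', d') := by
  constructor
  · rintro ⟨_, -, ht, he, hsrc, htgt, -, hupd, hguard⟩
    obtain ⟨e, heP, rfl⟩ := List.mem_map.1 he
    obtain rfl : g = e.src := loc.injective hsrc
    obtain ⟨hclk, hen⟩ := isState_iff.1 ht
    have upd_eq (η : Fin 2) : t.en η = (d η + e.instr.upd η : ℤ) := by
      simpa [state] using hupd η
    have hnonneg (η : Fin 2) : 0 ≤ (d η + e.instr.upd η : ℤ) := by
      exact_mod_cast (hen η).trans_eq (upd_eq η)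
    choose d' hd' using fun η => Int.eq_ofNat_of_zero_le (hnonneg η)
    refine ⟨e.tgt, d', ?_, .mk heP ⟨hguard, fun η => (hd' η).symm⟩⟩
    obtain ⟨l, clk, en⟩ := t
    simp only [state, METAState.mk.injEq]
    refine ⟨htgt, hclk, funext fun η => (upd_eq η).trans ?_⟩
    rw [hd' η, Int.cast_natCast]
  · rintro ⟨_, d', rfl, hstep⟩
    cases hstep with
    | @mk e _ _ he h =>
      refine ⟨_, isState_state _ _, isState_state _ _, List.mem_map_of_mem he, rfl, rfl,
        fun _ => ⟨fun _ => rfl, fun _ => rfl⟩, fun η => ?_, h.1⟩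
      simp only [state]
      exact_mod_cast h.2 η

theorem exists_step_state_iff {g : G} {d : Fin 2 → ℕ} {δ : ℝ} {t : METAState L (Fin 1) (Fin 2)} :
    (∃ e, (P.toMETA loc).Step (state (loc g) d) δ e t) ↔
      δ = 0 ∧ ∃ g' d', t = state (loc g') d' ∧ P.Step (g, d) (g', d') := by
  simp only [GuardedMETA.Step, delay_state_iff, ← exists_fire_state_iff, and_assoc,
    exists_and_left, exists_eq_left]

theorem exists_run_nil : ∃ r : (P.toMETA loc).Run (state (loc P.init) 0),
    r.duration = 0 ∧ (r.Visits {loc P.priv} ↔ P.init = P.priv) := by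
  rw [← initState_toMETA]
  exact ⟨.start, rfl, by simp [GuardedMETA.Run.Visits, toMETA]⟩

theorem exists_run_concat {g g' : G} {d d' : Fin 2 → ℕ} (r : (P.toMETA loc).Run (state (loc g) d))
    (h : P.Step (g, d) (g', d')) :
    ∃ r' : (P.toMETA loc).Run (state (loc g') d'), r'.duration = r.duration ∧
      (r'.Visits {loc P.priv} ↔ r.Visits {loc P.priv} ∨ g' = P.priv) := by
  obtain ⟨e, he⟩ := exists_step_state_iff.2 ⟨rfl, g', d', rfl, h⟩
  exact ⟨.step r 0 e he, by simp [GuardedMETA.Run.duration],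
    by simp [GuardedMETA.Run.Visits, state]⟩

theorem exists_path_of_run {s : METAState L (Fin 1) (Fin 2)} (r : (P.toMETA loc).Run s) :
    r.duration = 0 ∧ ∃ g d, s = state (loc g) d ∧ ReflTransGen P.Step (P.init, 0) (g, d) ∧
      (r.Visits {loc P.priv} → P.PrivatePath (P.init, 0) (g, d)) ∧
      (¬ r.Visits {loc P.priv} → P.PublicPath (P.init, 0) (g, d)) := by
  induction r with
  | start =>
    refine ⟨rfl, P.init, 0, initState_toMETA, .refl, fun h => ?_, fun h => ⟨?_, .refl⟩⟩
    · have hpriv : P.init = P.priv := by simpa [GuardedMETA.Run.Visits, toMETA] using h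
      exact ⟨0, hpriv ▸ .refl, hpriv ▸ .refl⟩
    · simpa [GuardedMETA.Run.Visits, toMETA] using h
  | step r δ e hstep ih =>
    obtain ⟨hdur, g, d, rfl, hpath, hpriv, hpub⟩ := ih
    obtain ⟨rfl, g', d', rfl, hgg'⟩ := exists_step_state_iff.1 ⟨e, hstep⟩
    have visits_iff : (r.step 0 e hstep).Visits {loc P.priv} ↔
        r.Visits {loc P.priv} ∨ g' = P.priv := by simp [GuardedMETA.Run.Visits, state]
    rw [visits_iff, not_or]
    refine ⟨by simp [GuardedMETA.Run.duration, hdur], g', d', rfl, hpath.tail hgg', ?_, ?_⟩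
    · rintro (h | rfl)
      · obtain ⟨e, hinit, htail⟩ := hpriv h
        exact ⟨e, hinit, htail.tail hgg'⟩
      · exact ⟨d', hpath.tail hgg', .refl⟩
    · rintro ⟨h, hg'⟩
      exact ⟨(hpub h).1, (hpub h).2.tail ⟨hgg', hg'⟩⟩

theorem exists_run_of_path {x : G × (Fin 2 → ℕ)} (h : ReflTransGen P.Step (P.init, 0) x) :
    ∃ r : (P.toMETA loc).Run (state (loc x.1) x.2), r.duration = 0 := by
  induction h with
  | refl =>
    obtain ⟨r, hr, -⟩ := exists_run_nil (P := P) (loc := loc)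
    exact ⟨r, hr⟩
  | tail _ hstep ih =>
    obtain ⟨r, hr⟩ := ih
    obtain ⟨r', hr', -⟩ := exists_run_concat r hstep
    exact ⟨r', hr'.trans hr⟩

theorem exists_run_of_privatePath {x : G × (Fin 2 → ℕ)} (h : P.PrivatePath (P.init, 0) x) :
    ∃ r : (P.toMETA loc).Run (state (loc x.1) x.2), r.duration = 0 ∧ r.Visits {loc P.priv} := by
  obtain ⟨e, hinit, htail⟩ := h
  induction htail with
  | refl =>
    obtain ⟨r, hr⟩ := exists_run_of_path (loc := loc) hinit
    exact ⟨r, hr, r.visits_of_loc_mem (Finset.mem_singleton_self _)⟩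
  | tail _ hstep ih =>
    obtain ⟨r, hr, hvisits⟩ := ih
    obtain ⟨r', hr', hvisits'⟩ := exists_run_concat r hstep
    exact ⟨r', hr'.trans hr, hvisits'.2 (.inl hvisits)⟩

theorem exists_run_of_publicPath {x : G × (Fin 2 → ℕ)} (h : P.PublicPath (P.init, 0) x) :
    ∃ r : (P.toMETA loc).Run (state (loc x.1) x.2), r.duration = 0 ∧ ¬ r.Visits {loc P.priv} := by
  obtain ⟨hinit, hpath⟩ := h
  induction hpath with
  | refl =>
    obtain ⟨r, hr, hvisits⟩ := exists_run_nil (P := P) (loc := loc)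
    exact ⟨r, hr, hvisits.not.2 hinit⟩
  | tail _ hstep ih =>
    obtain ⟨r, hr, hvisits⟩ := ih
    obtain ⟨r', hr', hvisits'⟩ := exists_run_concat r hstep.1
    exact ⟨r', hr'.trans hr, fun h => (hvisits'.1 h).elim hvisits hstep.2⟩

theorem privDurEnergies_toMETA : (P.toMETA loc).privDurEnergies =
    {x | ∃ d : Fin 2 → ℕ,
      P.PrivatePath (P.init, 0) (P.final, d) ∧ x = (0, fun η => (d η : ℝ))} := by
  ext ⟨δ, v⟩
  constructor
  · rintro ⟨s, r, ⟨hfinal, hvisits⟩, rfl, rfl⟩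
    obtain ⟨hdur, g, d, rfl, -, hpriv, -⟩ := exists_path_of_run r
    obtain rfl : g = P.final := by simpa [toMETA, state] using hfinal
    exact ⟨d, hpriv hvisits, Prod.ext hdur rfl⟩
  · rintro ⟨d, hpath, hx⟩
    obtain ⟨r, hdur, hvisits⟩ := exists_run_of_privatePath (loc := loc) hpath
    obtain ⟨rfl, rfl⟩ := Prod.ext_iff.1 hx
    exact ⟨_, r, ⟨by simp [toMETA, state], hvisits⟩, hdur, rfl⟩

theorem pubDurEnergies_toMETA : (P.toMETA loc).pubDurEnergies =
    {x | ∃ d : Fin 2 → ℕ,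
      P.PublicPath (P.init, 0) (P.final, d) ∧ x = (0, fun η => (d η : ℝ))} := by
  ext ⟨δ, v⟩
  constructor
  · rintro ⟨s, r, ⟨hfinal, hvisits⟩, rfl, rfl⟩
    obtain ⟨hdur, g, d, rfl, -, -, hpub⟩ := exists_path_of_run r
    obtain rfl : g = P.final := by simpa [toMETA, state] using hfinal
    exact ⟨d, hpub hvisits, Prod.ext hdur rfl⟩
  · rintro ⟨d, hpath, hx⟩
    obtain ⟨r, hdur, hvisits⟩ := exists_run_of_publicPath (loc := loc) hpath
    obtain ⟨rfl, rfl⟩ := Prod.ext_iff.1 hx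
    exact ⟨_, r, ⟨by simp [toMETA, state], hvisits⟩, hdur, rfl⟩

end CounterProgram

/-! ### The reduction -/

/-- The locations of a program graph with locations `Q` together with three new ones. -/
inductive GadgetLoc (Q : Type) where
  | init | priv | final
  | inner (q : Q)

instance {Q : Type} [Finite Q] : Finite (GadgetLoc Q) :=
  .of_surjective (Sum.elim ![.init, .priv, .final] .inner) fun
    | .init => ⟨.inl 0, rfl⟩
    | .priv => ⟨.inl 1, rfl⟩
    | .final => ⟨.inl 2, rfl⟩
    | .inner q => ⟨.inr q, rfl⟩

/-- The program whose private paths lead from `init` directly to `priv` and on to `final`, and whose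
public paths put `c` into the first counter and pass through the graph with edges `E` from the entry
`a` to the exit `b`. -/
def gadget {Q : Type} (E : List (ProgramEdge CounterInstr Q)) (a b : Q) (c : ℕ) :
    CounterProgram (GadgetLoc Q) where
  edges := ⟨.init, ⟨[], ![c, 0]⟩, .inner a⟩ :: ⟨.init, .silent, .priv⟩ ::
    ⟨.priv, .silent, .final⟩ :: ⟨.inner b, .silent, .final⟩ :: E.map (.map .inner)
  init := .init
  priv := .priv
  final := .final
  final_ne_priv := nofun
  src_ne_final := by simp [ProgramEdge.map]

section gadget

variable {Q : Type} {E : List (ProgramEdge CounterInstr Q)} {a b : Q} {c : ℕ}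

open CounterInstr (sem sem_silent)

theorem eq_zero_of_gadget_path_priv {e : Fin 2 → ℕ}
    (h : ReflTransGen (gadget E a b c).Step (.init, 0) (.priv, e)) : e = 0 := by
  let Inv : GadgetLoc Q × (Fin 2 → ℕ) → Prop
    | (.init, d) => d = 0
    | (.priv, d) => d = 0
    | _ => True
  suffices ∀ x, ReflTransGen (gadget E a b c).Step (.init, 0) x → Inv x from this _ h
  intro x hx
  induction hx with
  | refl => exact rfl
  | tail _ hstep ih =>
    obtain ⟨he, hsem⟩ := hstep
    simp only [gadget, List.mem_cons, List.mem_map] at he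
    rcases he with rfl | rfl | rfl | rfl | ⟨e, -, rfl⟩
    · trivial
    · exact (sem_silent.1 hsem).trans ih
    all_goals trivial

theorem gadget_path_priv_final_iff {d e : Fin 2 → ℕ} :
    ReflTransGen (gadget E a b c).Step (.priv, e) (.final, d) ↔ d = e := by
  constructor
  · let Inv : GadgetLoc Q × (Fin 2 → ℕ) → Prop
      | (.priv, d) => d = e
      | (.final, d) => d = e
      | _ => False
    intro h
    suffices ∀ x, ReflTransGen (gadget E a b c).Step (.priv, e) x → Inv x from this _ h
    intro x hx
    induction hx with
    | refl => exact rfl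
    | tail _ hstep ih =>
      obtain ⟨he, hsem⟩ := hstep
      simp only [gadget, List.mem_cons, List.mem_map] at he
      rcases he with rfl | rfl | rfl | rfl | ⟨e, -, rfl⟩
      · exact ih.elim
      · exact ih.elim
      · exact (sem_silent.1 hsem).trans ih
      all_goals exact ih.elim
  · rintro rfl
    exact .single (.silent (fun _ _ => sem_silent) (by simp [gadget]) d)

theorem gadget_privatePath_iff {d : Fin 2 → ℕ} :
    (gadget E a b c).PrivatePath (.init, 0) (.final, d) ↔ d = 0 := by
  constructor
  · rintro ⟨e, hinit, hfinal⟩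
    obtain rfl := eq_zero_of_gadget_path_priv hinit
    exact gadget_path_priv_final_iff.1 hfinal
  · rintro rfl
    exact ⟨0, .single (.silent (fun _ _ => sem_silent) (by simp [gadget]) 0),
      gadget_path_priv_final_iff.2 rfl⟩

theorem sem_put_iff {d : Fin 2 → ℕ} : sem ⟨[], ![c, 0]⟩ 0 d ↔ d = ![c, 0] := by
  simp [sem, SimpleConstraint.Sat, funext_iff, Fin.forall_fin_two]

theorem gadget_publicPath_iff {d : Fin 2 → ℕ} :
    (gadget E a b c).PublicPath (.init, 0) (.final, d) ↔
      ReflTransGen (ProgramStep sem E) (a, ![c, 0]) (b, d) := by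
  constructor
  · rintro ⟨-, hpath⟩
    let Inv : GadgetLoc Q × (Fin 2 → ℕ) → Prop
      | (.init, d) => d = 0
      | (.priv, _) => False
      | (.final, d) => ReflTransGen (ProgramStep sem E) (a, ![c, 0]) (b, d)
      | (.inner q, d) => ReflTransGen (ProgramStep sem E) (a, ![c, 0]) (q, d)
    suffices ∀ x, ReflTransGen (fun y z => (gadget E a b c).Step y z ∧ z.1 ≠ .priv) (.init, 0) x →
      Inv x from this _ hpath
    intro x hx
    induction hx with
    | refl => exact rfl
    | tail _ hstep ih =>
      obtain ⟨⟨he, hsem⟩, hpriv⟩ := hstep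
      simp only [gadget, List.mem_cons, List.mem_map] at he
      rcases he with rfl | rfl | rfl | rfl | ⟨e, he, rfl⟩
      · obtain rfl : _ = 0 := ih
        rw [sem_put_iff.1 hsem]
      · exact hpriv rfl
      · exact ih.elim
      · rw [sem_silent.1 hsem]
        exact ih
      · exact ReflTransGen.tail ih (.mk he hsem)
  · intro h
    have hentry : (gadget E a b c).Step (.init, 0) (.inner a, ![c, 0]) :=
      .mk List.mem_cons_self (sem_put_iff.2 rfl)
    have hexit : (gadget E a b c).Step (.inner b, d) (.final, d) :=
      .silent (fun _ _ => sem_silent) (by simp [gadget]) d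
    have hinner : ReflTransGen (fun y z => (gadget E a b c).Step y z ∧ z.1 ≠ .priv)
        (.inner a, ![c, 0]) (.inner b, d) := by
      refine h.lift (Prod.map GadgetLoc.inner id) ?_
      rintro _ _ @⟨e, _, _, he, hstep⟩
      have hmem : e.map .inner ∈ (gadget E a b c).edges := by
        simp [gadget, List.mem_map_of_mem he]
      exact ⟨.mk hmem hstep, nofun⟩
    exact ⟨nofun, (hinner.head ⟨hentry, nofun⟩).tail ⟨hexit, nofun⟩⟩

theorem gadget_opaque_iff {L : Type} (loc : GadgetLoc Q ↪ L) {D : Prop}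
    (hE : ∀ d, ReflTransGen (ProgramStep sem E) (a, ![c, 0]) (b, d) ↔ D ∧ d = 0)
    (δ : OpacityKind) (σ : Observation) : ((gadget E a b c).toMETA loc).Opaque δ σ ↔ D := by
  have zero_eq : (fun η => ((0 : Fin 2 → ℕ) η : ℝ)) = 0 := funext fun _ => Nat.cast_zero
  refine GuardedMETA.opaque_iff_of_privDurEnergies_eq_singleton (x := (0, 0)) ?_ ?_ δ σ
  · rw [CounterProgram.privDurEnergies_toMETA]
    ext x
    refine (exists_congr fun d => and_congr_left' gadget_privatePath_iff).trans ?_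
    rw [exists_eq_left, zero_eq, Set.mem_singleton_iff]
  · rw [CounterProgram.pubDurEnergies_toMETA]
    ext x
    refine (exists_congr fun d => and_congr_left' (gadget_publicPath_iff.trans (hE d))).trans ?_
    simp only [and_assoc, exists_and_left, exists_eq_left, zero_eq, Set.mem_ofPred_eq]

end gadget

theorem primrec_natCast_int : Primrec (Nat.cast : ℕ → ℤ) :=
  Primrec.encode_iff.1 (Primrec.nat_mul.comp (.const 2) .id)

theorem primrec_pow (b : ℕ) : Primrec fun n : ℕ => b ^ n := by
  refine (Primrec.nat_rec₁ (f := fun _ x => x * b) 1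
    (Primrec.nat_mul.comp .snd (.const b))).of_eq fun n => ?_
  induction n with
  | zero => rfl
  | succ n ih => rw [pow_succ, ← ih]

theorem primrec_gadget_code {Q : Type} {N : ℕ} (loc : GadgetLoc Q ↪ Fin N)
    (E : List (ProgramEdge CounterInstr Q)) (a b : Q) :
    Primrec fun c => ((gadget E a b c).toMETA loc).code := by
  simp only [GuardedMETA.code, CounterProgram.toMETA, gadget, List.map_cons, METAEdge.code,
    List.ofFn_succ (n := 1), List.ofFn_succ (n := 0), List.ofFn_zero]
  refine .pair (.const _) <| .pair (.const _) <| .pair (.const _) <| .pair (.const _) <|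
    .pair (.const _) <| .pair (.const _) <| .pair (.const _) <| .pair (.const _) <|
    .pair (.const _) <| .pair (.const _) <| Primrec.list_cons.comp ?_ (.const _)
  exact .pair (.const _) <| .pair (.const _) <| .pair (.const _) <| .pair (.const _) <|
    .pair (Primrec.list_cons.comp primrec_natCast_int (.const [0])) (.const _)

theorem DecidableOnMETAs.computablePred {C P : ∀ ⦃k n x m : ℕ⦄, FinMETA k n x m → Prop}
    (h : DecidableOnMETAs C P) {α : Type*} [Primcodable α] {k n x m : ℕ} {A : α → FinMETA k n x m}
    (hA : Computable fun i => (A i).code) (hC : ∀ i, C (A i)) :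
    ComputablePred fun i => P (A i) := by
  obtain ⟨f, hf, hdecides⟩ := h
  choose ans hmem hans using fun i => hdecides (A i) (hC i)
  have hcomp : Computable ans := Partrec.of_eq_tot (hf.comp hA) hmem
  exact ComputablePred.computable_iff.2 ⟨ans, hcomp, funext fun i => propext (hans i).symm⟩

theorem exists_discrete_opaque_iff_dom {f : ℕ →. ℕ} (hf : Nat.Partrec f) :
    ∃ (N : ℕ) (A : ℕ → FinMETA 0 N 1 2), Computable (fun n => (A n).code) ∧
      ∀ n, (A n).IsDiscrete ∧ ∀ δ σ, (A n).Opaque δ σ ↔ (f n).Dom := by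
  obtain ⟨T, hT, hTf⟩ := exists_rationalRel_iff_dom hf
  obtain ⟨Q, _, E, a, b, hE⟩ := exists_programComputes (fun _ _ => CounterInstr.sem_silent) hT
  obtain ⟨N, ⟨loc⟩⟩ := Finite.exists_equiv_fin (GadgetLoc Q)
  refine ⟨N, fun n => (gadget E a b (2 ^ n)).toMETA loc.toEmbedding,
    ((primrec_gadget_code _ E a b).comp (primrec_pow 2)).to_comp, fun n => ⟨fun _ _ => rfl, ?_⟩⟩
  exact gadget_opaque_iff _ fun d => (hE _ _).trans (by exact_mod_cast hTf n d)

theorem mainTheorem2 (δ : OpacityKind) (σ : Observation) :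
    ¬ DecidableOnMETAs
        (fun _ _ x m A => A.IsDiscrete ∧ m = 2 ∧ x = 1)
        (fun _ _ _ _ A => A.Opaque δ σ) := by
  intro hdec
  obtain ⟨N, A, hcode, hA⟩ := exists_discrete_opaque_iff_dom <| Partrec.nat_iff.1 <|
    Nat.Partrec.Code.eval_part.comp (Computable.ofNat Nat.Partrec.Code) (.const 0)
  have hencode : Computable fun c : Nat.Partrec.Code => (A (Encodable.encode c)).code :=
    hcode.comp Computable.encode
  refine ComputablePred.halting_problem 0 <|
    (hdec.computablePred hencode fun c => ⟨(hA _).1, rfl, rfl⟩).of_eq fun c => ?_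
  rw [(hA _).2, Denumerable.ofNat_encode]
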